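/- Let $T\in(0,\infty)$, $\Lambda>0$, $\Phi_0\in\mathbb R$, and let $(\Omega,\mathcal F,(\mathcal F_t)_{0\le t\le T},\mathbb P)$ be a filtered probability space satisfying the usual assumptions (right continuity and completeness; $\mathcal F_0$ need not be trivial). Let $S=(S_t)_{0\le t\le T}$ be an adapted process with right-continuous paths with left limits (RCLL), not necessarily a semimartingale, such that $$\mathbb E\Big[\int_0^T S_t^2\,dt\Big]<\infty ,$$ and assume that $\Phi_0S_0$ is integrable (i.e. $\mathbb E|S_0|<\infty$ unless $\Phi_0=0$). Let $\mathcal A_{\Phi_0}$ be the set of progressively measurable processes $\phi=(\phi_t)_{0\le t\le T}$ with $\int_0^T\phi_t^2\,dt<\infty$ and $\Phi_0+\int_0^T\phi_t\,dt=0$ almost surely, and for $\phi\in\mathcal A_{\Phi_0}$ put $$V_T^{\Phi_0,\phi}=-\Phi_0S_0-\int_0^T\phi_tS_t\,dt-\frac{\Lambda}{2}\int_0^T\phi_t^2\,dt .$$ Then $\mathbb E[V_T^{\Phi_0,\phi}]\in[-\infty,\infty)$ is well defined for every $\phi\in\mathcal A_{\Phi_0}$. Let $M$ be the RCLL version of the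 martingale $M_t=\mathbb E\big[\int_0^TS_u\,du\,\big|\,\mathcal F_t\big]$, $t\in[0,T]$, and let $\int_0^t\frac{dM_u}{T-u}$, $t\in[0,T)$, denote the (RCLL) stochastic integral. The problem of maximizing $\mathbb E[V_T^{\Phi_0,\phi}]$ over $\phi\in\mathcal A_{\Phi_0}$ has a solution, unique up to $dt\otimes\mathbb P$-null sets, given by $$\hat\phi_t=-\frac{\Phi_0}{T}+\frac{M_0}{T\Lambda}+\frac1\Lambda\Big(\int_0^t\frac{dM_u}{T-u}-S_t\Big),\qquad t\in[0,T)$$ (with, say, $\hat\phi_T=0$), and the optimal value is $$\max_{\phi\in\mathcal A_{\Phi_0}}\mathbb E\big[V_T^{\Phi_0,\phi}\big]=\mathbb E\big[V_T^{\Phi_0,\hat\phi}\big]=-\frac{\Phi_0^2\Lambda}{2T}+\Phi_0\,\mathbb E\Big[\frac{M_0}{T}-S_0\Big]+\frac1{2\Lambda}\,\mathbb E\Big[\int_0^T\Big(S_t-\frac{M_0}{T}-\int_0^t\frac{dM_u}{T-u}\Big)^2dt\Big],$$ where the right-hand side is finite (and the middle term is read as $0$ if $\Phi_0=0$). -/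

import Mathlib

open MeasureTheory Filter Topology

namespace Liquidation

/-- The set of trading times `[0, T]`. It carries the subspace topology, the order and the Lebesgue
measure (`volume`) inherited from `ℝ`; in particular `∫ t : TimeSet T, f t` is `∫₀ᵀ f t dt`. -/
abbrev TimeSet (T : ℝ) : Type := Set.Icc (0 : ℝ) T

noncomputable instance instMeasureSpaceTimeSet {T : ℝ} : MeasureSpace (TimeSet T) :=
  Measure.Subtype.measureSpace

/-- The initial time `0`, as an element of `[0, T]`. -/
def time0 {T : ℝ} (hT : 0 < T) : TimeSet T := ⟨0, le_rfl, hT.le⟩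

/-- The path `x` is right continuous with a (finite) left limit at time `t`. -/
def IsRCLLAt {T : ℝ} (x : TimeSet T → ℝ) (t : TimeSet T) : Prop :=
  ContinuousWithinAt x (Set.Ici t) t ∧ ∃ l : ℝ, Tendsto x (𝓝[<] t) (𝓝 l)

/-- The usual assumptions on a filtration `(ℱ_t)_{0 ≤ t ≤ T}`: it is right continuous, and already
`ℱ_0` contains all `P`-null sets (`P s` is the outer measure of the arbitrary set `s`). -/
structure UsualAssumptions {Ω : Type*} {mΩ : MeasurableSpace Ω} {T : ℝ} (hT : 0 < T)
    (ℱ : Filtration (TimeSet T) mΩ) (P : Measure Ω) : Prop where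
  rightContinuous : ℱ.IsRightContinuous
  complete : ∀ s : Set Ω, P s = 0 → MeasurableSet[ℱ (time0 hT)] s

/-- `M` is the right continuous with left limits version of the martingale
`M_t = E[∫₀ᵀ S_u du | ℱ_t]`, `t ∈ [0, T]`. -/
structure IsPriceMartingale {Ω : Type*} {mΩ : MeasurableSpace Ω} {T : ℝ}
    (ℱ : Filtration (TimeSet T) mΩ) (P : Measure Ω) (S M : TimeSet T → Ω → ℝ) : Prop where
  adapted : Adapted ℱ M
  rcll : ∀ ω t, IsRCLLAt (fun s => M s ω) t
  eq_condExp : ∀ t, M t =ᵐ[P] P[fun ω => ∫ u, S u ω | ℱ t]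

/-- `τ 0 ≤ τ 1 ≤ ⋯ ≤ τ n` is a partition of `[0, t]`. -/
structure IsPartition {T : ℝ} (hT : 0 < T) (t : TimeSet T) (n : ℕ) (τ : ℕ → TimeSet T) : Prop where
  mono : Monotone τ
  first : τ 0 = time0 hT
  last : τ n = t

/-- The Itô (left-point) Riemann sum `∑_{i < n} H_{τ_i} (M_{τ_{i+1}} - M_{τ_i})`. -/
def itoSum {Ω : Type*} {T : ℝ} (H M : TimeSet T → Ω → ℝ) (n : ℕ) (τ : ℕ → TimeSet T) (ω : Ω) : ℝ :=
  ∑ i ∈ Finset.range n, H (τ i) ω * (M (τ (i + 1)) ω - M (τ i) ω)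

/-- `N` is the stochastic integral process `N_t = ∫₀ᵗ H_u dM_u`, `t ∈ [0, T)`, of an integrand `H`
that is adapted and continuous on `[0, T)`: `N` is adapted, its paths are right continuous with left
limits on `[0, T)`, and for each `t < T` the Itô sums along every sequence of partitions of `[0, t]`
whose mesh tends to zero converge to `N_t` in probability. The value of `N` at `T` is irrelevant. -/
structure IsStochasticIntegral {Ω : Type*} {mΩ : MeasurableSpace Ω} {T : ℝ} (hT : 0 < T)
    (ℱ : Filtration (TimeSet T) mΩ) (P : Measure Ω) (H M N : TimeSet T → Ω → ℝ) : Prop where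
  adapted : ∀ t : TimeSet T, (t : ℝ) < T → Measurable[ℱ t] (N t)
  rcll : ∀ ω, ∀ t : TimeSet T, (t : ℝ) < T → IsRCLLAt (fun s => N s ω) t
  tendsto_itoSum : ∀ t : TimeSet T, (t : ℝ) < T →
    ∀ (n : ℕ → ℕ) (τ : ℕ → ℕ → TimeSet T), (∀ k, IsPartition hT t (n k) (τ k)) →
      (∀ ε : ℝ, 0 < ε → ∀ᶠ k in atTop, ∀ i < n k, ((τ k (i + 1) : ℝ) - (τ k i : ℝ)) < ε) →
      TendstoInMeasure P (fun k => itoSum H M (n k) (τ k)) atTop (N t)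

/-- The integrand `1 / (T - u)`. -/
noncomputable def kernel {Ω : Type*} {T : ℝ} : TimeSet T → Ω → ℝ := fun u _ => 1 / (T - (u : ℝ))

/-- The admissible trading rates: the progressively measurable `φ` with `∫₀ᵀ φ_t² dt < ∞` and
`Φ₀ + ∫₀ᵀ φ_t dt = 0` almost surely. -/
structure IsAdmissible {Ω : Type*} {mΩ : MeasurableSpace Ω} {T : ℝ}
    (ℱ : Filtration (TimeSet T) mΩ) (P : Measure Ω) (Φ₀ : ℝ) (φ : TimeSet T → Ω → ℝ) : Prop where
  progressive : IsProgressive ℱ φ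
  sq_integrable : ∀ᵐ ω ∂P, ∫⁻ t, ENNReal.ofReal (φ t ω ^ 2) < ⊤
  liquidates : ∀ᵐ ω ∂P, Φ₀ + ∫ t, φ t ω = 0

/-- The profit and loss `V_T = -Φ₀ S₀ - ∫₀ᵀ φ_t S_t dt - (Λ/2) ∫₀ᵀ φ_t² dt`. -/
noncomputable def profit {Ω : Type*} {T : ℝ} (hT : 0 < T) (S : TimeSet T → Ω → ℝ) (Λ Φ₀ : ℝ)
    (φ : TimeSet T → Ω → ℝ) (ω : Ω) : ℝ :=
  -Φ₀ * S (time0 hT) ω - (∫ t, φ t ω * S t ω) - Λ / 2 * ∫ t, φ t ω ^ 2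

/-- The expectation `E[X] = E[X⁺] - E[X⁻]` with values in `[-∞, ∞]`, meaningful as soon as one of
the two terms is finite. -/
noncomputable def extExpectation {Ω : Type*} {mΩ : MeasurableSpace Ω} (P : Measure Ω)
    (X : Ω → ℝ) : EReal :=
  ((∫⁻ ω, ENNReal.ofReal (X ω) ∂P : ENNReal) : EReal)
    - ((∫⁻ ω, ENNReal.ofReal (-X ω) ∂P : ENNReal) : EReal)

/-- `φ` maximizes `E[V_T]` over the admissible rates. -/
def IsOptimal {Ω : Type*} {mΩ : MeasurableSpace Ω} {T : ℝ} (hT : 0 < T)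
    (ℱ : Filtration (TimeSet T) mΩ) (P : Measure Ω) (S : TimeSet T → Ω → ℝ) (Λ Φ₀ : ℝ)
    (φ : TimeSet T → Ω → ℝ) : Prop :=
  IsAdmissible ℱ P Φ₀ φ ∧ ∀ ψ : TimeSet T → Ω → ℝ, IsAdmissible ℱ P Φ₀ ψ →
    extExpectation P (profit hT S Λ Φ₀ ψ) ≤ extExpectation P (profit hT S Λ Φ₀ φ)

open Classical in
/-- The rate `-Φ₀/T + M₀/(TΛ) + (1/Λ) (N_t - S_t)` for `t ∈ [0, T)`, set to zero at time `T`; here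
`N_t` stands for `∫₀ᵗ dM_u/(T-u)`. -/
noncomputable def candidateRate {Ω : Type*} {T : ℝ} (hT : 0 < T) (S M N : TimeSet T → Ω → ℝ)
    (Λ Φ₀ : ℝ) (t : TimeSet T) (ω : Ω) : ℝ :=
  if (t : ℝ) < T then
    -Φ₀ / T + M (time0 hT) ω / (T * Λ) + 1 / Λ * (N t ω - S t ω)
  else 0

end Liquidation

open Liquidation

/-! Write `X = ∫₀ᵀ S dt`, let `‖·‖` and `⟨·,·⟩` be the norm and inner product of `L²(dt ⊗ P)`, and
let `K_t = M₀/T + ∫₀ᵗ dM_u/(T-u)`. The theorem rests on two facts about `K`: it is orthogonal to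
every square integrable adapted `ψ` with `∫₀ᵀ ψ dt = 0`, and `∫₀ᵀ K dt = ∫₀ᵀ S dt` almost surely.
Put `c = Φ₀/T`. For admissible `φ` the process `φ + c` has zero time integral, so `⟨K, φ + c⟩ = 0`,
and completing the square gives `E[V_T] = const - (Λ/2) ‖φ - φ̂‖²` with `φ̂ = -c + (K - S)/Λ`
(`integral_profit_eq`). The second fact makes `φ̂` admissible, so it is the unique maximizer. Rates
outside `L²` have expected profit `-∞` (`IsAdmissible.sqIntegrable_or_eq_bot`). Since `1/(T-u)` is
smooth and deterministic on `[0, T)`, integration by parts turns `K` into a pathwise formula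
(`kernelPath`), from which `∫₀ᵗ K du + (T-t) K_t = M_t`. Thus `K` stopped at `t`, written `K^t`, has
time integral `M_t` (`integral_stoppedKernel`). As `K` is a martingale on `[0, T)`, `E[K_t ∫ψ] =
⟨K^t, ψ⟩` for adapted `ψ`. With `ψ = K^t` and `ψ = S` this gives `‖K^t‖² = E[K_t M_t] = E[K_t X] =
⟨K^t, S⟩`, hence `‖K^t‖ ≤ ‖S‖` uniformly in `t`. This bound allows `t → T` in both facts. The
existence of `M` is proved by Doob's regularization: the maximal and upcrossing inequalities along
dyadic times, followed by right limits. -/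

namespace Liquidation

/-! ### Lebesgue measure on `[0, T]`. -/

section TimeMeasure

variable {T : ℝ}

theorem measurePreserving_coe_timeSet :
    MeasurePreserving (Subtype.val : TimeSet T → ℝ) volume (volume.restrict (Set.Icc 0 T)) :=
  measurePreserving_subtype_coe measurableSet_Icc

instance instIsFiniteMeasureTimeSet : IsFiniteMeasure (volume : Measure (TimeSet T)) := by
  constructor
  rw [← Set.preimage_univ (f := (Subtype.val : TimeSet T → ℝ)),
    measurePreserving_coe_timeSet.measure_preimage MeasurableSet.univ.nullMeasurableSet]
  simp

theorem measurableEmbedding_coe_timeSet : MeasurableEmbedding (Subtype.val : TimeSet T → ℝ) :=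
  MeasurableEmbedding.subtype_coe measurableSet_Icc

instance instNullSingletonClassTimeSet :
    NullSingletonClass (volume : Measure (TimeSet T)) := by
  constructor
  intro x
  have h := (measurePreserving_coe_timeSet (T := T)).measure_preimage_emb (measurableEmbedding_coe_timeSet)
    ({(x : ℝ)} : Set ℝ)
  have : (Subtype.val ⁻¹' {(x : ℝ)} : Set (TimeSet T)) = {x} := by
    ext y; simp [Subtype.ext_iff]
  rw [this] at h
  rw [h]
  simp

theorem setIntegral_Ioc_timeSet (a b : TimeSet T) (hab : a ≤ b) (g : ℝ → ℝ) :
    ∫ u in Set.Ioc a b, g (u : ℝ) = ∫ u in (a : ℝ)..b, g u := by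
  have h := (measurePreserving_coe_timeSet (T := T)).setIntegral_preimage_emb
    (measurableEmbedding_coe_timeSet) g (Set.Ioc (a : ℝ) b)
  have h2 : (Subtype.val ⁻¹' Set.Ioc (a : ℝ) b : Set (TimeSet T)) = Set.Ioc a b := by
    ext y; simp
  rw [h2] at h
  rw [h, intervalIntegral.integral_of_le hab, Measure.restrict_restrict measurableSet_Ioc]
  congr 2
  rw [Set.inter_eq_left]
  exact fun y hy => ⟨a.2.1.trans hy.1.le, hy.2.trans b.2.2⟩

theorem volume_Ioc_timeSet (a b : TimeSet T) (hab : a ≤ b) :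
    (volume : Measure (TimeSet T)).real (Set.Ioc a b) = b - a := by
  have h := setIntegral_Ioc_timeSet a b hab (fun _ => 1)
  simpa using h

theorem volume_real_univ_timeSet (hT : 0 < T) :
    (volume : Measure (TimeSet T)).real Set.univ = T := by
  have h := measurePreserving_coe_timeSet (T := T) |>.measureReal_preimage (s := Set.univ)
    MeasurableSet.univ.nullMeasurableSet
  rw [Set.preimage_univ] at h
  rw [h]
  simp [hT.le]

/-- The final time. -/
def timeEnd (hT : 0 < T) : TimeSet T := ⟨T, hT.le, le_rfl⟩

theorem time0_le (hT : 0 < T) (t : TimeSet T) : time0 hT ≤ t := t.2.1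

theorem le_timeEnd (hT : 0 < T) (t : TimeSet T) : t ≤ timeEnd hT := t.2.2

theorem volume_Ioi_timeSet (a : TimeSet T) :
    (volume : Measure (TimeSet T)).real (Set.Ioi a) = T - a := by
  have hT : 0 ≤ T := a.2.1.trans a.2.2
  have : Set.Ioi a = Set.Ioc a ⟨T, hT, le_rfl⟩ := by
    ext x; simp only [Set.mem_Ioi, Set.mem_Ioc, iff_self_and]; intro _; exact x.2.2
  rw [this, volume_Ioc_timeSet _ _ a.2.2]

theorem ae_lt_timeSet : ∀ᵐ t : TimeSet T, (t : ℝ) < T := by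
  rcases lt_or_ge 0 T with hT | hT
  · have : ∀ᵐ t : TimeSet T, t ≠ timeEnd hT := by
      rw [ae_iff]; simp
    filter_upwards [this] with t ht
    exact lt_of_le_of_ne t.2.2 fun h => ht (Subtype.ext h)
  · rw [ae_iff]
    have : Subsingleton (TimeSet T) := ⟨fun a b => Subtype.ext (by
      have := a.2.1; have := a.2.2; have := b.2.1; have := b.2.2; linarith)⟩
    exact Set.Subsingleton.measure_zero (Set.subsingleton_of_subsingleton) _

/-- `∫_a^b du / (T - u)² = 1 / (T - b) - 1 / (T - a)`. -/
theorem integral_inv_sq (a b : TimeSet T) (hab : a ≤ b) (hb : (b : ℝ) < T) :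
    ∫ u in Set.Ioc a b, 1 / (T - (u : ℝ)) ^ 2 = 1 / (T - b) - 1 / (T - a) := by
  rw [setIntegral_Ioc_timeSet a b hab (fun u => 1 / (T - u) ^ 2)]
  have hne : ∀ x ∈ Set.uIcc (a : ℝ) b, T - x ≠ 0 := by
    intro x hx
    rw [Set.uIcc_of_le (by exact hab)] at hx
    have := hx.2
    intro h; linarith
  rw [intervalIntegral.integral_eq_sub_of_hasDerivAt (f := fun u => 1 / (T - u))]
  · intro x hx
    have h := ((hasDerivAt_id x).const_sub T).inv (hne x hx)
    simpa [one_div] using! h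
  · apply ContinuousOn.intervalIntegrable
    refine ContinuousOn.div continuousOn_const (by fun_prop) ?_
    intro x hx
    exact pow_ne_zero _ (hne x hx)

theorem inv_sq_le (u t : TimeSet T) (hut : u ≤ t) (ht : (t : ℝ) < T) :
    1 / (T - (u : ℝ)) ^ 2 ≤ 1 / (T - (t : ℝ)) ^ 2 := by
  have : (u : ℝ) ≤ t := hut
  have h1 : 0 < T - (t : ℝ) := by linarith
  gcongr

end TimeMeasure

/-! ### Boundedness of RCLL paths. -/

section Paths

variable {T : ℝ}

/-- Right continuity and the left limit bound the path near each point; compactness of `[0, T]` does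
the rest. The bound supplies the dominating constants in all pathwise limits. -/
theorem exists_bound_of_rcll {x : TimeSet T → ℝ} (hx : ∀ t, IsRCLLAt x t) :
    ∃ C, ∀ t, |x t| ≤ C := by
  suffices h : ∃ C, ∀ t ∈ (Set.univ : Set (TimeSet T)), |x t| ≤ C by
    simpa using h
  refine IsCompact.induction_on (p := fun s => ∃ C, ∀ t ∈ s, |x t| ≤ C)
    (isCompact_univ (X := TimeSet T)) ⟨0, by simp⟩ ?_ ?_ ?_
  · rintro s t hst ⟨C, hC⟩
    exact ⟨C, fun u hu => hC u (hst hu)⟩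
  · rintro s t ⟨C, hC⟩ ⟨D, hD⟩
    refine ⟨max C D, ?_⟩
    rintro u (hu | hu)
    · exact (hC u hu).trans (le_max_left _ _)
    · exact (hD u hu).trans (le_max_right _ _)
  · intro t _
    obtain ⟨h1, l, h2⟩ := hx t
    have e1 : ∀ᶠ s in 𝓝[≥] t, |x s| ≤ |x t| + 1 :=
      (h1.abs.eventually (gt_mem_nhds (lt_add_one _))).mono fun _ h => le_of_lt h
    have e2 : ∀ᶠ s in 𝓝[<] t, |x s| ≤ |l| + 1 :=
      (h2.abs.eventually (gt_mem_nhds (lt_add_one _))).mono fun _ h => le_of_lt h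
    refine ⟨{s | |x s| ≤ max (|x t| + 1) (|l| + 1)}, ?_, _, fun _ h => h⟩
    rw [nhdsWithin_univ, ← nhdsLT_sup_nhdsGE]
    exact ⟨e2.mono fun _ h => h.trans (le_max_right _ _),
      e1.mono fun _ h => h.trans (le_max_left _ _)⟩

end Paths

/-! ### Progressive measurability. -/

section Progressive

variable {Ω : Type*} {mΩ : MeasurableSpace Ω} {T : ℝ} {ℱ : Filtration (TimeSet T) mΩ}
  {X : TimeSet T → Ω → ℝ}

/-- The process is the pointwise limit of its values at grid times just to the right. Right
continuity is required only before `T`, because the stochastic integral and the candidate rate are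
controlled only there. -/
theorem isProgressive_of_rightContinuous (hX : Adapted ℱ X)
    (hrc : ∀ ω, ∀ t : TimeSet T, (t : ℝ) < T →
      ContinuousWithinAt (fun s => X s ω) (Set.Ici t) t) : IsProgressive ℱ X := by
  intro i
  let : MeasurableSpace Ω := ℱ i
  -- Capping the grid at `i` keeps every sampled value `ℱ i`-measurable.
  let e : ℕ → ℕ → TimeSet T := fun n k => ⟨min i ((k + 1 : ℕ) / (n + 1 : ℕ)),
    le_min i.2.1 (by positivity), (min_le_left _ _).trans i.2.2⟩
  let d : ℕ → TimeSet T → TimeSet T := fun n u => e n ⌊(u : ℝ) * (n + 1 : ℕ)⌋₊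
  have hei : ∀ n k, e n k ≤ i := fun n k => Subtype.coe_le_coe.1 (min_le_left _ _)
  have hfloor : ∀ n (u : TimeSet T), (u : ℝ) ≤ (⌊(u : ℝ) * (n + 1 : ℕ)⌋₊ + 1 : ℕ) / (n + 1 : ℕ) := by
    intro n u
    rw [le_div_iff₀ (by positivity)]
    push_cast
    exact_mod_cast (Nat.lt_floor_add_one _).le
  have hfloor2 : ∀ n (u : TimeSet T),
      ((⌊(u : ℝ) * (n + 1 : ℕ)⌋₊ + 1 : ℕ) : ℝ) / (n + 1 : ℕ) ≤ u + 1 / ((n : ℝ) + 1) := by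
    intro n u
    rw [div_le_iff₀ (by positivity)]
    have h := Nat.floor_le (a := (u : ℝ) * (n + 1 : ℕ)) (mul_nonneg u.2.1 (by positivity))
    have h2 : (u + 1 / ((n : ℝ) + 1)) * (n + 1 : ℕ) = (u : ℝ) * (n + 1 : ℕ) + 1 := by
      push_cast; field_simp
    rw [h2]; push_cast at h ⊢; linarith
  have hmeas : ∀ n, Measurable fun p : Set.Iic i × Ω => X (d n p.1) p.2 := by
    intro n
    have h1 : Measurable fun q : ℕ × Ω => X (e n q.1) q.2 :=
      measurable_from_prod_countable_right fun k => (hX (e n k)).mono (ℱ.mono (hei n k)) le_rfl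
    have h2 : Measurable fun p : Set.Iic i × Ω =>
        ((⌊((p.1 : TimeSet T) : ℝ) * (n + 1 : ℕ)⌋₊, p.2) : ℕ × Ω) := by
      refine Measurable.prodMk ?_ measurable_snd
      refine Nat.measurable_floor.comp ?_
      refine Measurable.mul_const ?_ _
      exact measurable_subtype_coe.comp (measurable_subtype_coe.comp measurable_fst)
    exact h1.comp h2
  refine measurable_of_tendsto_metrizable hmeas ?_
  rw [tendsto_pi_nhds]
  rintro ⟨⟨u, hu⟩, ω⟩
  change Tendsto (fun n => X (d n u) ω) atTop (𝓝 (X u ω))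
  have hu' : u ≤ i := hu
  have hle : ∀ n, u ≤ d n u := fun n => Subtype.coe_le_coe.1 (le_min hu' (hfloor n u))
  rcases lt_or_ge (u : ℝ) T with hlt | hge
  · refine (hrc ω u hlt).tendsto.comp ?_
    refine tendsto_nhdsWithin_iff.2 ⟨?_, Eventually.of_forall hle⟩
    rw [tendsto_subtype_rng]
    refine tendsto_of_tendsto_of_tendsto_of_le_of_le (g := fun _ => (u : ℝ))
      (h := fun n : ℕ => (u : ℝ) + 1 / ((n : ℝ) + 1)) tendsto_const_nhds ?_ (fun n => hle n)
      fun n => (min_le_right _ _).trans (hfloor2 n u)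
    simpa using tendsto_one_div_add_atTop_nhds_zero_nat.const_add (u : ℝ)
  -- At the final time the sampled time is exact, so no continuity is used.
  · have : ∀ n, d n u = u := fun n => le_antisymm
      (Subtype.coe_le_coe.1 ((d n u).2.2.trans hge)) (hle n)
    simp [this]

theorem measurable_uncurry_of_isProgressive (hT : 0 < T) (hX : IsProgressive ℱ X) :
    Measurable fun p : TimeSet T × Ω => X p.1 p.2 := by
  have h1 := (hX (timeEnd hT)).mono (sup_le_sup le_rfl
    (MeasurableSpace.comap_mono (ℱ.le (timeEnd hT)))) le_rfl
  have h2 : Measurable fun p : TimeSet T × Ω =>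
      ((⟨p.1, le_timeEnd hT p.1⟩, p.2) : Set.Iic (timeEnd hT) × Ω) :=
    (measurable_fst.subtype_mk).prodMk measurable_snd
  exact h1.comp h2

/-- The running integral of a progressive process is adapted. -/
theorem measurable_setIntegral_of_isProgressive (hX : IsProgressive ℱ X) (t : TimeSet T) :
    Measurable[ℱ t] fun ω => ∫ u in Set.Iic t, X u ω := by
  have h : StronglyMeasurable[ℱ t] fun ω => ∫ u : Set.Iic t, X u ω ∂(Measure.comap Subtype.val volume) :=
    let := ℱ t
    StronglyMeasurable.integral_prod_left (f := fun (u : Set.Iic t) (ω : Ω) => X u ω)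
      (μ := Measure.comap Subtype.val volume) (hX t).stronglyMeasurable
  have e : ∀ ω, ∫ u in Set.Iic t, X u ω = ∫ u : Set.Iic t, X u ω ∂(Measure.comap Subtype.val volume) :=
    fun ω => (integral_subtype_comap measurableSet_Iic fun u => X u ω).symm
  simp only [e]
  exact h.measurable

end Progressive

/-! ### Dyadic times. -/

section Grid

variable {T : ℝ}

/-- The dyadic grid `k T / 2ⁿ` of `[0, T]`, constant equal to `T` from `k = 2ⁿ` on. -/
noncomputable def dyadicGrid (hT : 0 < T) (n k : ℕ) : TimeSet T :=
  ⟨T * min 1 ((k : ℝ) / 2 ^ n), mul_nonneg hT.le (le_min zero_le_one (by positivity)),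
    mul_le_of_le_one_right hT.le (min_le_left _ _)⟩

theorem dyadicGrid_monotone (hT : 0 < T) (n : ℕ) : Monotone (dyadicGrid hT n) := by
  intro i j hij
  refine Subtype.coe_le_coe.1 (mul_le_mul_of_nonneg_left (min_le_min_left _ ?_) hT.le)
  gcongr

theorem coe_dyadicGrid (hT : 0 < T) {n k : ℕ} (hk : k ≤ 2 ^ n) :
    (dyadicGrid hT n k : ℝ) = T * (k / 2 ^ n) := by
  have : (k : ℝ) / 2 ^ n ≤ 1 := by
    rw [div_le_one (by positivity)]
    exact_mod_cast hk
  simp [dyadicGrid, min_eq_right this]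

theorem dyadicGrid_zero (hT : 0 < T) (n : ℕ) : dyadicGrid hT n 0 = time0 hT := by
  apply Subtype.ext
  rw [coe_dyadicGrid hT (Nat.zero_le _)]
  simp [time0]

theorem dyadicGrid_last (hT : 0 < T) (n : ℕ) : dyadicGrid hT n (2 ^ n) = timeEnd hT := by
  apply Subtype.ext
  rw [coe_dyadicGrid hT le_rfl]
  simp [timeEnd]

theorem dyadicGrid_refine (hT : 0 < T) {n m : ℕ} (hnm : n ≤ m) (k : ℕ) :
    dyadicGrid hT m (k * 2 ^ (m - n)) = dyadicGrid hT n k := by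
  apply Subtype.ext
  have h : ((k * 2 ^ (m - n) : ℕ) : ℝ) / 2 ^ m = k / 2 ^ n := by
    obtain ⟨d, rfl⟩ := Nat.exists_eq_add_of_le hnm
    push_cast
    rw [Nat.add_sub_cancel_left, pow_add]
    field_simp
  push_cast at h
  simp [dyadicGrid, h]

/-- The points of the `n`-th dyadic grid. -/
def gridSet (hT : 0 < T) (n : ℕ) : Set (TimeSet T) := {t | ∃ k ≤ 2 ^ n, t = dyadicGrid hT n k}

/-- All dyadic points. -/
def dyadicSet (hT : 0 < T) : Set (TimeSet T) := {t | ∃ n, t ∈ gridSet hT n}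

theorem gridSet_mono (hT : 0 < T) {n m : ℕ} (hnm : n ≤ m) : gridSet hT n ⊆ gridSet hT m := by
  rintro t ⟨k, hk, rfl⟩
  refine ⟨k * 2 ^ (m - n), ?_, (dyadicGrid_refine hT hnm k).symm⟩
  calc k * 2 ^ (m - n) ≤ 2 ^ n * 2 ^ (m - n) := Nat.mul_le_mul_right _ hk
    _ = 2 ^ m := by rw [← pow_add, Nat.add_sub_cancel' hnm]

theorem exists_dyadic_between (hT : 0 < T) {s t : TimeSet T} (hst : s < t) :
    ∃ r ∈ dyadicSet hT, s < r ∧ r < t := by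
  have hst' : (s : ℝ) < t := hst
  obtain ⟨n, hn⟩ := pow_unbounded_of_one_lt (T / ((t : ℝ) - s)) one_lt_two
  have h2 : (0 : ℝ) < 2 ^ n := by positivity
  have hn' : T / 2 ^ n < t - s := by
    rw [div_lt_iff₀ (by linarith)] at hn
    rw [div_lt_iff₀ h2]; linarith
  set k := ⌊(s : ℝ) / T * 2 ^ n⌋₊ + 1 with hk
  have h3 : (s : ℝ) / T * 2 ^ n < k := by
    rw [hk]; push_cast; exact Nat.lt_floor_add_one _
  have h4 : (k : ℝ) ≤ (s : ℝ) / T * 2 ^ n + 1 := by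
    rw [hk]; push_cast
    have := Nat.floor_le (a := (s : ℝ) / T * 2 ^ n)
      (mul_nonneg (div_nonneg s.2.1 hT.le) h2.le)
    linarith
  have h5 : T * (k / 2 ^ n) < t := by
    have : T * (k / 2 ^ n) ≤ T * (((s : ℝ) / T * 2 ^ n + 1) / 2 ^ n) := by gcongr
    have e : T * (((s : ℝ) / T * 2 ^ n + 1) / 2 ^ n) = s + T / 2 ^ n := by field_simp
    linarith
  have h6 : (s : ℝ) < T * (k / 2 ^ n) := by
    have : T * ((s : ℝ) / T * 2 ^ n / 2 ^ n) < T * (k / 2 ^ n) := by gcongr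
    have e : T * ((s : ℝ) / T * 2 ^ n / 2 ^ n) = s := by field_simp
    linarith
  have hkn : k ≤ 2 ^ n := by
    have h7 : T * (k / 2 ^ n) < T * 1 := by linarith [t.2.2]
    have h8 := lt_of_mul_lt_mul_left h7 hT.le
    rw [div_lt_one h2] at h8
    exact_mod_cast h8.le
  refine ⟨dyadicGrid hT n k, ⟨n, k, hkn, rfl⟩, ?_, ?_⟩
  · rw [← Subtype.coe_lt_coe, coe_dyadicGrid hT hkn]; exact h6
  · rw [← Subtype.coe_lt_coe, coe_dyadicGrid hT hkn]; exact h5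

end Grid

/-! ### Upcrossings along a set of times. -/

section Chains

variable {α : Type*} [LinearOrder α]

/-- `x` makes `K` upcrossings of `(a, b)` at times in `D`, all of them after `l` and up to `u`. -/
def UpChain (D : Set α) (x : α → ℝ) (a b : ℝ) : ℕ → α → α → Prop
  | 0, _, _ => True
  | K + 1, l, u => ∃ p ∈ D, ∃ q ∈ D, l < p ∧ p ≤ q ∧ q ≤ u ∧ x p < a ∧ b < x q ∧
      UpChain D x a b K q u

variable {D : Set α} {x : α → ℝ} {a b : ℝ}

theorem UpChain.mono {D' : Set α} (hD : D ⊆ D') {K : ℕ} {l l' u u' : α} (hl : l' ≤ l) (hu : u ≤ u')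
    (h : UpChain D x a b K l u) : UpChain D' x a b K l' u' := by
  induction K generalizing l l' with
  | zero => trivial
  | succ K ih =>
    obtain ⟨p, hp, q, hq, h1, h2, h3, h4, h5, h6⟩ := h
    exact ⟨p, hD hp, q, hD hq, hl.trans_lt h1, h2, h3.trans hu, h4, h5, ih le_rfl h6⟩

theorem UpChain.append {K : ℕ} {l m p q u : α} (hlm : l ≤ m) (hp : p ∈ D) (hq : q ∈ D) (hmp : m < p)
    (hpq : p ≤ q) (hqu : q ≤ u) (hxp : x p < a) (hxq : b < x q) (h : UpChain D x a b K l m) :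
    UpChain D x a b (K + 1) l u := by
  induction K generalizing l with
  | zero => exact ⟨p, hp, q, hq, hlm.trans_lt hmp, hpq, hqu, hxp, hxq, trivial⟩
  | succ K ih =>
    obtain ⟨p', hp', q', hq', h1, h2, h3, h4, h5, h6⟩ := h
    exact ⟨p', hp', q', hq', h1, h2, (h3.trans hmp.le).trans (hpq.trans hqu), h4, h5, ih h3 h6⟩

/-- A chain involves only finitely many times, and these all belong to one of the increasing levels.
-/
theorem UpChain.exists_level {E : ℕ → Set α} (hE : ∀ n m, n ≤ m → E n ⊆ E m) {K : ℕ} {l u : α}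
    (h : UpChain {t | ∃ n, t ∈ E n} x a b K l u) :
    ∃ n₀, ∀ n ≥ n₀, UpChain (E n) x a b K l u := by
  induction K generalizing l with
  | zero => exact ⟨0, fun _ _ => trivial⟩
  | succ K ih =>
    obtain ⟨p, ⟨i, hp⟩, q, ⟨j, hq⟩, h1, h2, h3, h4, h5, h6⟩ := h
    obtain ⟨n₀, hn₀⟩ := ih h6
    refine ⟨max n₀ (max i j), fun n hn => ⟨p, ?_, q, ?_, h1, h2, h3, h4, h5, ?_⟩⟩
    · exact hE i n (by omega) hp
    · exact hE j n (by omega) hq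
    · exact hn₀ n (by omega)

end Chains

/-! ### Regularization of a path known at dyadic times. -/

section Oscillation

variable {T : ℝ} {x : TimeSet T → ℝ} {a b : ℝ} {D : Set (TimeSet T)}

/-- The crossings are chosen from the last to the first: below any crossing found, the interval down
to `t` still contains arbitrarily many others. On the left of `t` the choice runs forwards instead.
-/
theorem upChain_of_frequently_right {t : TimeSet T}
    (h1 : ∃ᶠ s in 𝓝[>] t ⊓ 𝓟 D, x s < a) (h2 : ∃ᶠ s in 𝓝[>] t ⊓ 𝓟 D, b < x s) (K : ℕ)
    {u : TimeSet T} (hu : t < u) : UpChain D x a b K t u := by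
  have key : ∀ {Q : TimeSet T → Prop}, (∃ᶠ s in 𝓝[>] t ⊓ 𝓟 D, Q s) → ∀ v, t < v →
      ∃ s ∈ D, t < s ∧ s < v ∧ Q s := by
    intro Q hQ v hv
    have : ∀ᶠ s in 𝓝[>] t ⊓ 𝓟 D, (t < s ∧ s < v) ∧ s ∈ D := by
      refine Eventually.and ?_ ?_
      · exact Filter.Eventually.filter_mono inf_le_left (Ioo_mem_nhdsGT hv)
      · exact Filter.Eventually.filter_mono inf_le_right (mem_principal_self D)
    obtain ⟨s, hs, ⟨⟨h3, h4⟩, h5⟩⟩ := (hQ.and_eventually this).exists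
    exact ⟨s, h5, h3, h4, hs⟩
  induction K generalizing u with
  | zero => trivial
  | succ K ih =>
    obtain ⟨q, hq, htq, hqu, hxq⟩ := key h2 u hu
    obtain ⟨p, hp, htp, hpq, hxp⟩ := key h1 q htq
    obtain ⟨m, htm, hmp⟩ := exists_between htp
    exact (ih htm).append htm.le hp hq hmp hpq.le hqu.le hxp hxq

theorem upChain_of_frequently_left {t : TimeSet T}
    (h1 : ∃ᶠ s in 𝓝[<] t ⊓ 𝓟 D, x s < a) (h2 : ∃ᶠ s in 𝓝[<] t ⊓ 𝓟 D, b < x s) (K : ℕ)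
    {l : TimeSet T} (hl : l < t) : UpChain D x a b K l t := by
  have key : ∀ {Q : TimeSet T → Prop}, (∃ᶠ s in 𝓝[<] t ⊓ 𝓟 D, Q s) → ∀ v, v < t →
      ∃ s ∈ D, v < s ∧ s < t ∧ Q s := by
    intro Q hQ v hv
    have : ∀ᶠ s in 𝓝[<] t ⊓ 𝓟 D, (v < s ∧ s < t) ∧ s ∈ D := by
      refine Eventually.and ?_ ?_
      · exact Filter.Eventually.filter_mono inf_le_left (Ioo_mem_nhdsLT hv)
      · exact Filter.Eventually.filter_mono inf_le_right (mem_principal_self D)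
    obtain ⟨s, hs, ⟨⟨h3, h4⟩, h5⟩⟩ := (hQ.and_eventually this).exists
    exact ⟨s, h5, h3, h4, hs⟩
  induction K generalizing l with
  | zero => trivial
  | succ K ih =>
    obtain ⟨p, hp, hlp, hpt, hxp⟩ := key h1 l hl
    obtain ⟨q, hq, hpq, hqt, hxq⟩ := key h2 p hpt
    exact ⟨p, hp, q, hq, hlp, hpq.le, hqt.le, hxp, hxq, ih hqt⟩

/-- A path along the dyadic points that is bounded and crosses every rational interval finitely
often. -/
structure IsTame (hT : 0 < T) (x : TimeSet T → ℝ) : Prop where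
  bounded : ∃ C, ∀ t ∈ dyadicSet hT, |x t| ≤ C
  crossings : ∀ a b : ℚ, a < b →
    ∃ K, ¬ UpChain (dyadicSet hT) x a b K (time0 hT) (timeEnd hT)

theorem exists_tendsto_of_no_oscillation (hb : ∃ C, ∀ t ∈ D, |x t| ≤ C) {F : Filter (TimeSet T)}
    (h : ∀ a b : ℚ, a < b → ¬ ((∃ᶠ s in F ⊓ 𝓟 D, x s < a) ∧ ∃ᶠ s in F ⊓ 𝓟 D, (b : ℝ) < x s)) :
    ∃ c, Tendsto x (F ⊓ 𝓟 D) (𝓝 c) := by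
  obtain ⟨C, hC⟩ := hb
  have hD : ∀ᶠ s in F ⊓ 𝓟 D, s ∈ D :=
    Filter.Eventually.filter_mono inf_le_right (mem_principal_self D)
  refine tendsto_of_no_upcrossings (s := Set.range ((↑) : ℚ → ℝ)) Rat.denseRange_cast ?_ ?_ ?_
  · rintro _ ⟨a, rfl⟩ _ ⟨b, rfl⟩ hab
    exact h a b (by exact_mod_cast hab)
  · exact ⟨C, by simpa using hD.mono fun s hs => (abs_le.1 (hC s hs)).2⟩
  · exact ⟨-C, by simpa using hD.mono fun s hs => (abs_le.1 (hC s hs)).1⟩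

theorem IsTame.exists_rightLim {hT : 0 < T} (hx : IsTame hT x) (t : TimeSet T) (ht : (t : ℝ) < T) :
    ∃ c, Tendsto x (𝓝[>] t ⊓ 𝓟 (dyadicSet hT)) (𝓝 c) := by
  refine exists_tendsto_of_no_oscillation hx.bounded fun a b hab h => ?_
  obtain ⟨K, hK⟩ := hx.crossings a b hab
  exact hK ((upChain_of_frequently_right h.1 h.2 K (u := timeEnd hT) ht).mono le_rfl
    (time0_le hT t) le_rfl)

theorem IsTame.exists_leftLim {hT : 0 < T} (hx : IsTame hT x) (t : TimeSet T) :
    ∃ c, Tendsto x (𝓝[<] t ⊓ 𝓟 (dyadicSet hT)) (𝓝 c) := by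
  refine exists_tendsto_of_no_oscillation hx.bounded fun a b hab h => ?_
  obtain ⟨K, hK⟩ := hx.crossings a b hab
  rcases (time0_le hT t).eq_or_lt with h0 | h0
  · have : 𝓝[<] t = ⊥ := by
      have : Set.Iio t = ∅ := by
        ext s; simpa [← h0] using time0_le hT s
      rw [this, nhdsWithin_empty]
    rw [this, bot_inf_eq] at h
    exact Filter.frequently_bot h.1
  · exact hK ((upChain_of_frequently_left h.1 h.2 K h0).mono le_rfl le_rfl (le_timeEnd hT t))

open Classical in
/-- The right-continuous regularization of a path given along the dyadic points. -/
noncomputable def regularize (hT : 0 < T) (x : TimeSet T → ℝ) (t : TimeSet T) : ℝ :=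
  if h : (t : ℝ) < T ∧ IsTame hT x then (h.2.exists_rightLim t h.1).choose
  else if IsTame hT x then x t else 0

theorem IsTame.tendsto_regularize {hT : 0 < T} (hx : IsTame hT x) (t : TimeSet T)
    (ht : (t : ℝ) < T) : Tendsto x (𝓝[>] t ⊓ 𝓟 (dyadicSet hT)) (𝓝 (regularize hT x t)) := by
  rw [regularize, dif_pos ⟨ht, hx⟩]
  exact (hx.exists_rightLim t ht).choose_spec

theorem regularize_of_not_isTame {hT : 0 < T} (hx : ¬ IsTame hT x) (t : TimeSet T) :
    regularize hT x t = 0 := by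
  rw [regularize, dif_neg (fun h => hx h.2), if_neg hx]

theorem IsTame.regularize_end {hT : 0 < T} (hx : IsTame hT x) (t : TimeSet T) (ht : ¬ (t : ℝ) < T) :
    regularize hT x t = x t := by
  rw [regularize, dif_neg (fun h => ht h.1), if_pos hx]

theorem neBot_right_dyadic (hT : 0 < T) {t : TimeSet T} (ht : (t : ℝ) < T) :
    (𝓝[>] t ⊓ 𝓟 (dyadicSet hT)).NeBot := by
  have htu : t < timeEnd hT := ht
  rw [inf_principal_neBot_iff]
  intro U hU
  obtain ⟨v, hv, hvU⟩ := (mem_nhdsGT_iff_exists_Ioo_subset' htu).1 hU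
  obtain ⟨r, hr, h1, h2⟩ := exists_dyadic_between hT (s := t) hv
  exact ⟨r, hvU ⟨h1, h2⟩, hr⟩

/-- Both one-sided limits of the regularized path are inherited from the limits along dyadic times.
The zero path, used when the original path is not tame, is trivially RCLL. -/
theorem isRCLLAt_regularize (hT : 0 < T) (x : TimeSet T → ℝ) (t : TimeSet T) :
    IsRCLLAt (regularize hT x) t := by
  by_cases hx : IsTame hT x
  swap
  · have : regularize hT x = fun _ => 0 := funext fun t => regularize_of_not_isTame hx t
    rw [this]
    exact ⟨continuousWithinAt_const, 0, tendsto_const_nhds⟩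
  -- A right limit of dyadic values in a closed set stays in it; closed neighbourhoods form a basis,
  -- so this transfers limits from dyadic times to all times.
  have hmem : ∀ {V : Set ℝ}, IsClosed V → ∀ {u v s : TimeSet T}, u ≤ s → s < v → (s : ℝ) < T →
      (∀ r ∈ dyadicSet hT, u < r → r < v → x r ∈ V) → regularize hT x s ∈ V := by
    intro V hV u v s hus hsv hs h
    have := neBot_right_dyadic hT hs
    refine hV.mem_of_tendsto (hx.tendsto_regularize s hs) ?_
    have e1 : ∀ᶠ r in 𝓝[>] s ⊓ 𝓟 (dyadicSet hT), s < r ∧ r < v :=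
      Filter.Eventually.filter_mono inf_le_left (Ioo_mem_nhdsGT hsv)
    have e2 : ∀ᶠ r in 𝓝[>] s ⊓ 𝓟 (dyadicSet hT), r ∈ dyadicSet hT :=
      Filter.Eventually.filter_mono inf_le_right (mem_principal_self _)
    filter_upwards [e1, e2] with r h1 h2 using h r h2 (hus.trans_lt h1.1) h1.2
  constructor
  · by_cases ht : (t : ℝ) < T
    · have htu : t < timeEnd hT := ht
      rw [ContinuousWithinAt, (closed_nhds_basis (regularize hT x t)).tendsto_right_iff]
      rintro V ⟨hV, hVc⟩
      have := (hx.tendsto_regularize t ht) hV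
      rw [mem_map, mem_inf_principal, mem_nhdsGT_iff_exists_Ioo_subset' htu] at this
      obtain ⟨v, hv, hvV⟩ := this
      filter_upwards [Ico_mem_nhdsGE (show t < v from hv)] with s hs
      refine hmem hVc hs.1 hs.2 (lt_of_lt_of_le (Subtype.coe_lt_coe.2 hs.2) v.2.2) ?_
      exact fun r hr h1 h2 => hvV ⟨h1, h2⟩ hr
    · have : Set.Ici t = {t} := by
        ext s
        constructor
        · intro h
          exact Subtype.ext (le_antisymm (s.2.2.trans (not_lt.1 ht)) h)
        · intro h
          exact (Set.mem_singleton_iff.1 h).ge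
      rw [this]
      exact continuousWithinAt_singleton
  · obtain ⟨c, hc⟩ := hx.exists_leftLim t
    refine ⟨c, ?_⟩
    rcases (time0_le hT t).eq_or_lt with h0 | h0
    · have : Set.Iio t = ∅ := by
        ext s; simpa [← h0] using time0_le hT s
      rw [this, nhdsWithin_empty]
      exact tendsto_bot
    rw [(closed_nhds_basis c).tendsto_right_iff]
    rintro V ⟨hV, hVc⟩
    have := hc hV
    rw [mem_map, mem_inf_principal, mem_nhdsLT_iff_exists_Ioo_subset' h0] at this
    obtain ⟨v, hv, hvV⟩ := this
    filter_upwards [Ioo_mem_nhdsLT (show v < t from hv)] with s hs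
    refine hmem hVc hs.1.le hs.2 (lt_of_lt_of_le (Subtype.coe_lt_coe.2 hs.2) t.2.2) ?_
    exact fun r hr h1 h2 => hvV ⟨h1, h2⟩ hr

end Oscillation

/-! ### Comparison of chains with discrete-time upcrossing counts. -/

section GridCrossings

variable {Ω : Type*} {mΩ : MeasurableSpace Ω} {T : ℝ}

/-- Each link of the chain raises the count by at least one. The shift to `i + 1` is there because
`upcrossingsBefore` at `N` sees only indices below `N`. -/
theorem upChain_le_upcrossingsBefore (hT : 0 < T) {Y : TimeSet T → Ω → ℝ} {ω : Ω} {a b : ℝ}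
    (hab : a < b) {n : ℕ} {K : ℕ} {i : ℕ} (hi : i ≤ 2 ^ n) {u : TimeSet T}
    (h : UpChain (gridSet hT n) (fun t => Y t ω) a b K (dyadicGrid hT n i) u) :
    upcrossingsBefore a b (fun k => Y (dyadicGrid hT n k)) (i + 1) ω + K ≤
      upcrossingsBefore a b (fun k => Y (dyadicGrid hT n k)) (2 ^ n + 1) ω := by
  induction K generalizing i with
  | zero => exact upcrossingsBefore_mono hab (show i + 1 ≤ 2 ^ n + 1 by omega) ω
  | succ K ih =>
    obtain ⟨_, ⟨j, hj, rfl⟩, _, ⟨k, hk, rfl⟩, h1, h2, h3, h4, h5, h6⟩ := h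
    have hij : i < j := (dyadicGrid_monotone hT n).reflect_lt h1
    -- Order of times gives order of indices unless the two times coincide, and then one value would
    -- be both below `a` and above `b`.
    have hjk : j ≤ k := by
      by_contra hlt
      have := le_antisymm h2 (dyadicGrid_monotone hT n (not_le.1 hlt).le)
      rw [this] at h4
      linarith
    have := upcrossingsBefore_lt_of_exists_upcrossing (f := fun k => Y (dyadicGrid hT n k)) (ω := ω)
      hab (N := i + 1) (N₁ := j) (by omega) h4 hjk h5
    have := ih hk h6
    omega

end GridCrossings

/-! ### Measurability up to null sets. -/

section Completeness

variable {Ω : Type*} {mΩ : MeasurableSpace Ω} {P : Measure Ω} {T : ℝ}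
  {ℱ : Filtration (TimeSet T) mΩ}

theorem measurable_of_ae_eq {m : MeasurableSpace Ω} (hm : ∀ s : Set Ω, P s = 0 → MeasurableSet[m] s)
    {f g : Ω → ℝ} (hg : Measurable[m] g) (hfg : f =ᵐ[P] g) : Measurable[m] f := by
  intro B hB
  have h0 : P {ω | ¬ f ω = g ω} = 0 := ae_iff.1 hfg
  have e : f ⁻¹' B = (g ⁻¹' B \ {ω | ¬ f ω = g ω}) ∪ (f ⁻¹' B ∩ {ω | ¬ f ω = g ω}) := by
    ext ω
    by_cases h : f ω = g ω <;> simp [h]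
  rw [e]
  exact ((hg hB).diff (hm _ h0)).union (hm _ (measure_mono_null Set.inter_subset_right h0))

theorem UsualAssumptions.measurable_of_ae_eq {hT : 0 < T} (hℱ : UsualAssumptions hT ℱ P)
    {t : TimeSet T} {f g : Ω → ℝ} (hg : Measurable[ℱ t] g) (hfg : f =ᵐ[P] g) : Measurable[ℱ t] f :=
  Liquidation.measurable_of_ae_eq
    (fun s hs => ℱ.mono (time0_le hT t) _ (hℱ.complete s hs)) hg hfg

end Completeness

/-! ### Existence of the RCLL version of the martingale. -/

section Regularization

variable {Ω : Type*} {mΩ : MeasurableSpace Ω} {P : Measure Ω} [IsProbabilityMeasure P] {T : ℝ}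
  {ℱ : Filtration (TimeSet T) mΩ} {X : Ω → ℝ}

/-- A filtration sampled along the `n`-th dyadic grid. -/
noncomputable def gridFiltration (hT : 0 < T) (ℱ : Filtration (TimeSet T) mΩ) (n : ℕ) :
    Filtration ℕ mΩ where
  seq k := ℱ (dyadicGrid hT n k)
  mono' _ _ hij := ℱ.mono (dyadicGrid_monotone hT n hij)
  le' _ := ℱ.le _

theorem martingale_gridFiltration (hT : 0 < T) (n : ℕ) :
    Martingale (fun k => P[X | ℱ (dyadicGrid hT n k)]) (gridFiltration hT ℱ n) P :=
  martingale_condExp X (gridFiltration hT ℱ n) P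

/-- Doob's maximal inequality for the submartingale `|E[X | ℱ_t]|`, written as a supremum of the
martingale and its negative. The bound involves only the terminal value, so it is the same for every
grid. -/
theorem measure_gridSet_maximal (hT : 0 < T) (n : ℕ) (m : ℕ) :
    (m : ENNReal) * P {ω | ∃ t ∈ gridSet hT n, (m : ℝ) ≤ |(P[X | ℱ t]) ω|} ≤
      ENNReal.ofReal (∫ ω, |(P[X | ℱ (timeEnd hT)]) ω| ∂P) := by
  have hM := martingale_gridFiltration (P := P) (ℱ := ℱ) (X := X) hT n
  have hS := hM.submartingale.sup hM.neg.submartingale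
  have h := maximal_ineq hS (fun k ω => abs_nonneg _) (ε := (m : NNReal)) (2 ^ n)
  have hset : {ω | ∃ t ∈ gridSet hT n, (m : ℝ) ≤ |(P[X | ℱ t]) ω|} ⊆
      {ω | (((m : NNReal) : ℝ)) ≤ (Finset.range (2 ^ n + 1)).sup' Finset.nonempty_range_add_one
        fun k => ((fun k => P[X | ℱ (dyadicGrid hT n k)]) ⊔
          -(fun k => P[X | ℱ (dyadicGrid hT n k)])) k ω} := by
    rintro ω ⟨_, ⟨k, hk, rfl⟩, h⟩
    refine le_trans ?_ (Finset.le_sup' (fun k => ((fun k => P[X | ℱ (dyadicGrid hT n k)]) ⊔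
          -(fun k => P[X | ℱ (dyadicGrid hT n k)])) k ω)
      (Finset.mem_range.2 (Nat.lt_succ_of_le hk)))
    rw [NNReal.coe_natCast]
    exact h
  refine le_trans ?_ (h.trans (ENNReal.ofReal_le_ofReal ?_))
  · gcongr
    simp
  · have e : ∀ ω, ((fun k => P[X | ℱ (dyadicGrid hT n k)]) ⊔
          -(fun k => P[X | ℱ (dyadicGrid hT n k)])) (2 ^ n) ω = |(P[X | ℱ (timeEnd hT)]) ω| := by
      intro ω
      rw [← dyadicGrid_last hT n]
      rfl
    simp only [e]
    exact setIntegral_le_integral integrable_condExp.abs (Eventually.of_forall fun _ => abs_nonneg _)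

/-- The event of unboundedness, multiplied by any `m`, keeps a measure below one finite constant, so
it is null. -/
theorem ae_bounded_dyadic (hT : 0 < T) :
    ∀ᵐ ω ∂P, ∃ C : ℝ, ∀ t ∈ dyadicSet hT, |(P[X | ℱ t]) ω| ≤ C := by
  set C := ENNReal.ofReal (∫ ω, |(P[X | ℱ (timeEnd hT)]) ω| ∂P)
  have key : ∀ m : ℕ, (m : ENNReal) *
      P {ω | ¬ ∃ C : ℝ, ∀ t ∈ dyadicSet hT, |(P[X | ℱ t]) ω| ≤ C} ≤ C := by
    intro m
    have hsub : {ω | ¬ ∃ C : ℝ, ∀ t ∈ dyadicSet hT, |(P[X | ℱ t]) ω| ≤ C} ⊆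
        ⋃ n, {ω | ∃ t ∈ gridSet hT n, (m : ℝ) ≤ |(P[X | ℱ t]) ω|} := by
      intro ω hω
      have hω' : ¬ ∃ C : ℝ, ∀ t ∈ dyadicSet hT, |(P[X | ℱ t]) ω| ≤ C := hω
      push Not at hω'
      obtain ⟨t, ⟨n, ht⟩, h⟩ := hω' m
      exact Set.mem_iUnion.2 ⟨n, t, ht, h.le⟩
    have hmono : Monotone fun n => {ω | ∃ t ∈ gridSet hT n, (m : ℝ) ≤ |(P[X | ℱ t]) ω|} := by
      rintro i j hij ω ⟨t, ht, h⟩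
      exact ⟨t, gridSet_mono hT hij ht, h⟩
    refine (mul_le_mul_right (measure_mono hsub) _).trans ?_
    rw [hmono.measure_iUnion, ENNReal.mul_iSup]
    exact iSup_le fun n => measure_gridSet_maximal hT n m
  rw [ae_iff]
  by_contra h0
  obtain ⟨m, hm⟩ := ENNReal.exists_nat_mul_gt (b := C) h0 ENNReal.ofReal_ne_top
  exact absurd (key m) (not_le.2 hm)

/-- Doob's upcrossing inequality bounds the expected counts uniformly over the grids, and Fatou's
lemma makes their `liminf` almost surely finite. Arbitrarily long dyadic chains would make it
infinite, since each one lives on all fine enough grids. -/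
theorem ae_finite_crossings (hT : 0 < T) {a b : ℝ} (hab : a < b) :
    ∀ᵐ ω ∂P, ∃ K, ¬ UpChain (dyadicSet hT) (fun t => (P[X | ℱ t]) ω) a b K
      (time0 hT) (timeEnd hT) := by
  let U : ℕ → Ω → ℕ := fun n =>
    upcrossingsBefore a b (fun k => P[X | ℱ (dyadicGrid hT n k)]) (2 ^ n + 1)
  have hM := fun n => martingale_gridFiltration (P := P) (ℱ := ℱ) (X := X) hT n
  have hmeas : ∀ n, Measurable fun ω => (U n ω : ENNReal) := fun n =>
    measurable_from_top.comp ((hM n).stronglyAdapted.measurable_upcrossingsBefore hab)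
  set C := (∫ ω, ((P[X | ℱ (timeEnd hT)]) ω - a)⁺ ∂P) / (b - a)
  have hbound : ∀ n, ∫⁻ ω, (U n ω : ENNReal) ∂P ≤ ENNReal.ofReal C := by
    intro n
    have h := (hM n).submartingale.mul_integral_upcrossingsBefore_le_integral_pos_part a b (2 ^ n + 1)
    have e : dyadicGrid hT n (2 ^ n + 1) = timeEnd hT := by
      refine le_antisymm (le_timeEnd hT _) ?_
      rw [← dyadicGrid_last hT n]
      exact dyadicGrid_monotone hT n (Nat.le_succ _)
    rw [e] at h
    have hint := (hM n).stronglyAdapted.integrable_upcrossingsBefore (μ := P) (N := 2 ^ n + 1) hab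
    have e2 : ∫⁻ ω, (U n ω : ENNReal) ∂P = ENNReal.ofReal (∫ ω, (U n ω : ℝ) ∂P) := by
      rw [ofReal_integral_eq_lintegral_ofReal hint (Eventually.of_forall fun _ => Nat.cast_nonneg _)]
      simp [U]
    rw [e2]
    refine ENNReal.ofReal_le_ofReal ?_
    rw [le_div_iff₀ (sub_pos.2 hab), mul_comm]
    exact h
  have hlim : ∫⁻ ω, liminf (fun n => (U n ω : ENNReal)) atTop ∂P ≠ ⊤ := by
    refine ne_top_of_le_ne_top (ENNReal.ofReal_ne_top (r := C)) ?_
    refine (lintegral_liminf_le hmeas).trans ?_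
    exact liminf_le_of_le (by isBoundedDefault) fun c hc => by
      obtain ⟨n, hn⟩ := hc.exists
      exact hn.trans (hbound n)
  filter_upwards [ae_lt_top (.liminf hmeas) hlim] with ω hω
  by_contra! hall
  refine hω.ne (ENNReal.eq_top_of_forall_nnreal_le fun r => ?_)
  obtain ⟨K, hK⟩ := exists_nat_ge r
  obtain ⟨n₀, hn₀⟩ := (hall K).exists_level (E := gridSet hT) (fun n m h => gridSet_mono hT h)
  refine le_liminf_of_le (by isBoundedDefault) ?_
  filter_upwards [eventually_ge_atTop n₀] with n hn
  have h1 := hn₀ n hn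
  rw [← dyadicGrid_zero hT n] at h1
  have h2 := upChain_le_upcrossingsBefore hT (Y := fun t => P[X | ℱ t]) hab (Nat.zero_le _) h1
  have h3 : K ≤ U n ω := le_trans (Nat.le_add_left _ _) h2
  calc (r : ENNReal) ≤ ((K : NNReal) : ENNReal) := by exact_mod_cast hK
    _ = (K : ENNReal) := by simp
    _ ≤ U n ω := by exact_mod_cast h3

theorem ae_isTame (hT : 0 < T) : ∀ᵐ ω ∂P, IsTame hT fun t => (P[X | ℱ t]) ω := by
  have h : ∀ᵐ ω ∂P, ∀ a b : ℚ, (a : ℚ) < b →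
      ∃ K, ¬ UpChain (dyadicSet hT) (fun t => (P[X | ℱ t]) ω) a b K (time0 hT) (timeEnd hT) := by
    simp only [ae_all_iff]
    exact fun a b hab => ae_finite_crossings hT (by exact_mod_cast hab)
  filter_upwards [ae_bounded_dyadic (P := P) (ℱ := ℱ) (X := X) hT, h] with ω h1 h2 using ⟨h1, h2⟩

/-- Along dyadic times decreasing to `t` the conditional expectations are uniformly integrable, so
the almost sure limit is also an `L¹` limit and keeps the integrals over sets of `ℱ t`. Right
continuity of the filtration makes the limit measurable at time `t`. -/
theorem regularize_ae_eq_condExp (hT : 0 < T) (hℱ : UsualAssumptions hT ℱ P)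
    (hX : Integrable X P) (t : TimeSet T) :
    (fun ω => regularize hT (fun s => (P[X | ℱ s]) ω) t) =ᵐ[P] P[X | ℱ t] := by
  by_cases ht : (t : ℝ) < T
  swap
  · filter_upwards [ae_isTame (P := P) (ℱ := ℱ) (X := X) hT] with ω hω using hω.regularize_end t ht
  have hnb := neBot_right_dyadic hT ht
  obtain ⟨s, hs⟩ := exists_seq_tendsto (𝓝[>] t ⊓ 𝓟 (dyadicSet hT))
  set Z : Ω → ℝ := fun ω => regularize hT (fun s => (P[X | ℱ s]) ω) t with hZ
  have hlim : ∀ᵐ ω ∂P, Tendsto (fun n => (P[X | ℱ (s n)]) ω) atTop (𝓝 (Z ω)) := by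
    filter_upwards [ae_isTame (P := P) (ℱ := ℱ) (X := X) hT] with ω hω
    exact (hω.tendsto_regularize t ht).comp hs
  have hgt : ∀ u, t < u → ∀ᶠ n in atTop, t < s n ∧ s n < u := fun u hu =>
    (hs.mono_right inf_le_left).eventually (Ioo_mem_nhdsGT hu)
  have htu : t < timeEnd hT := ht
  have hUI := hX.uniformIntegrable_condExp (ℱ := fun n => ℱ (s n)) fun n => ℱ.le _
  have hZL := hUI.memLp_of_ae_tendsto hlim
  have hL1 := tendsto_Lp_finite_of_tendsto_ae le_rfl ENNReal.one_ne_top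
    (fun n => (integrable_condExp (m := ℱ (s n)) (f := X) (μ := P)).aestronglyMeasurable) hZL
    hUI.unifIntegrable hlim
  have hZint := memLp_one_iff_integrable.1 hZL
  refine ae_eq_condExp_of_forall_setIntegral_eq (ℱ.le t) hX (fun _ _ _ => hZint.integrableOn) ?_ ?_
  · intro A hA _
    have h1 := tendsto_setIntegral_of_L1' Z hZint.aestronglyMeasurable
      (Eventually.of_forall fun n => integrable_condExp) hL1 A
    refine tendsto_nhds_unique h1 (tendsto_const_nhds.congr' ?_)
    filter_upwards [hgt _ htu] with n hn
    exact (setIntegral_condExp (ℱ.le _) hX (ℱ.mono hn.1.le A hA)).symm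
  -- The `limsup` depends only on tails, so it is `ℱ u`-measurable for each `u > t`.
  · refine ⟨fun ω => limsup (fun n => (P[X | ℱ (s n)]) ω) atTop, ?_, ?_⟩
    · refine Measurable.stronglyMeasurable ?_
      have hRC := hℱ.rightContinuous
      have hle : ⨅ j > t, ℱ j ≤ ℱ t := by
        rw [← Filtration.rightCont_eq_of_not_isMax ℱ
          fun h => absurd (h (le_timeEnd hT t)) (not_le.2 htu)]
        exact Filtration.IsRightContinuous.RC t
      refine Measurable.mono ?_ hle le_rfl
      intro B hB
      simp only [MeasurableSpace.measurableSet_iInf]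
      intro u hu
      obtain ⟨k, hk⟩ := eventually_atTop.1 (hgt u hu)
      have : Measurable[ℱ u] fun ω => limsup (fun n => (P[X | ℱ (s n)]) ω) atTop := by
        have e : (fun ω => limsup (fun n => (P[X | ℱ (s n)]) ω) atTop) =
            fun ω => limsup (fun n => (P[X | ℱ (s (n + k))]) ω) atTop :=
          funext fun ω => (limsup_nat_add (fun n => (P[X | ℱ (s n)]) ω) k).symm
        rw [e]
        refine Measurable.limsup fun n => ?_
        exact stronglyMeasurable_condExp.measurable.mono
          (ℱ.mono (hk (n + k) (Nat.le_add_left _ _)).2.le) le_rfl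
      exact this hB
    · filter_upwards [hlim] with ω hω using hω.limsup_eq.symm

theorem exists_isPriceMartingale (hT : 0 < T) (hℱ : UsualAssumptions hT ℱ P)
    {S : TimeSet T → Ω → ℝ} (hX : Integrable (fun ω => ∫ u, S u ω) P) :
    ∃ M, IsPriceMartingale ℱ P S M :=
  ⟨fun t ω => regularize hT (fun s => (P[fun ω => ∫ u, S u ω | ℱ s]) ω) t,
    fun t => hℱ.measurable_of_ae_eq stronglyMeasurable_condExp.measurable
      (regularize_ae_eq_condExp hT hℱ hX t),
    fun _ t => isRCLLAt_regularize hT _ t,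
    fun t => regularize_ae_eq_condExp hT hℱ hX t⟩

end Regularization

/-! ### The integral of `1/(T-u)` against a path, by integration by parts. -/

section PathwiseIntegral

variable {T : ℝ}

/-- The path `x t / (T - t) - ∫₀ᵗ x u / (T - u)² du`, which by integration by parts is
`x 0 / T + ∫₀ᵗ dx u / (T - u)`. -/
noncomputable def kernelPath (x : TimeSet T → ℝ) (t : TimeSet T) : ℝ :=
  x t / (T - t) - ∫ u in Set.Iic t, x u * (1 / (T - (u : ℝ)) ^ 2)

variable {x : TimeSet T → ℝ} {C : ℝ}

theorem measurable_inv_sq : Measurable fun u : TimeSet T => 1 / (T - (u : ℝ)) ^ 2 :=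
  (((measurable_const.sub measurable_subtype_coe).pow_const 2)).const_div 1

theorem Iic_time_ae_eq_Ioc (hT : 0 < T) (t : TimeSet T) :
    (Set.Iic t : Set (TimeSet T)) =ᵐ[volume] Set.Ioc (time0 hT) t := by
  have h : (Set.Iic t : Set (TimeSet T)) = Set.Icc (time0 hT) t := by
    ext s; simp [time0_le hT s]
  rw [h]
  exact Ioc_ae_eq_Icc.symm

theorem integrableOn_mul_inv_sq (hx : Measurable x) (hC : ∀ t, |x t| ≤ C) {t : TimeSet T}
    (ht : (t : ℝ) < T) {A : Set (TimeSet T)} (hA : MeasurableSet A) (hAt : A ⊆ Set.Iic t) :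
    IntegrableOn (fun u => x u * (1 / (T - (u : ℝ)) ^ 2)) A := by
  refine Measure.integrableOn_of_bounded (M := C * (1 / (T - (t : ℝ)) ^ 2))
    (measure_ne_top _ _) (hx.mul measurable_inv_sq).aestronglyMeasurable ?_
  filter_upwards [ae_restrict_mem hA] with u hu
  rw [norm_mul, Real.norm_eq_abs, Real.norm_of_nonneg (by positivity)]
  exact mul_le_mul (hC u) (inv_sq_le u t (hAt hu) ht) (by positivity)
    ((abs_nonneg _).trans (hC u))

/-- Summation by parts: the left-point sums against `x` become right-point sums against the kernel.
Right-point values are what right continuity of `x` can handle. -/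
theorem itoSum_eq {n : ℕ} {τ : ℕ → TimeSet T} (k : TimeSet T → ℝ) :
    ∑ i ∈ Finset.range n, k (τ i) * (x (τ (i + 1)) - x (τ i)) =
      k (τ n) * x (τ n) - k (τ 0) * x (τ 0) -
        ∑ i ∈ Finset.range n, x (τ (i + 1)) * (k (τ (i + 1)) - k (τ i)) := by
  induction n with
  | zero => simp
  | succ n ih => rw [Finset.sum_range_succ, ih, Finset.sum_range_succ]; ring

/-- The right-point approximation of `x` along a partition. -/
noncomputable def rightStep (x : TimeSet T → ℝ) (n : ℕ) (τ : ℕ → TimeSet T) (u : TimeSet T) : ℝ :=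
  ∑ i ∈ Finset.range n, (Set.Ioc (τ i) (τ (i + 1))).indicator (fun _ => x (τ (i + 1))) u

theorem measurable_rightStep (n : ℕ) (τ : ℕ → TimeSet T) : Measurable (rightStep x n τ) :=
  Finset.measurable_fun_sum _ fun _ _ => measurable_const.indicator measurableSet_Ioc

theorem exists_rightStep_eq {n : ℕ} {τ : ℕ → TimeSet T} (hτ : Monotone τ) {u : TimeSet T}
    (h0 : τ 0 < u) (hn : u ≤ τ n) :
    ∃ i < n, τ i < u ∧ u ≤ τ (i + 1) ∧ rightStep x n τ u = x (τ (i + 1)) := by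
  have hex : ∃ j, u ≤ τ j := ⟨n, hn⟩
  classical
  obtain ⟨j, hj, hmin⟩ : ∃ j, u ≤ τ j ∧ ∀ i < j, ¬ u ≤ τ i :=
    ⟨Nat.find hex, Nat.find_spec hex, fun i hi => Nat.find_min hex hi⟩
  obtain ⟨i, rfl⟩ : ∃ i, j = i + 1 := Nat.exists_eq_succ_of_ne_zero (by
    rintro rfl; exact absurd hj (not_le.2 h0))
  have hi : τ i < u := not_le.1 (hmin i (Nat.lt_succ_self i))
  have hin : i < n := by
    by_contra h
    exact absurd hi (not_lt.2 (hn.trans (hτ (not_lt.1 h))))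
  refine ⟨i, hin, hi, hj, ?_⟩
  rw [rightStep, Finset.sum_eq_single_of_mem i (Finset.mem_range.2 hin)]
  · rw [Set.indicator_of_mem (Set.mem_Ioc.2 ⟨hi, hj⟩)]
  · intro l _ hl
    refine Set.indicator_of_notMem ?_ _
    rintro ⟨h1, h2⟩
    rcases lt_or_gt_of_ne hl with h | h
    · exact absurd hi (not_lt.2 (h2.trans (hτ h)))
    · exact absurd h1 (not_lt.2 (hj.trans (hτ h)))

theorem sum_mul_sub_eq_integral (hC : ∀ t, |x t| ≤ C) (hT : 0 < T)
    {t : TimeSet T} (ht : (t : ℝ) < T) {n : ℕ} {τ : ℕ → TimeSet T} (hτ : IsPartition hT t n τ) :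
    ∑ i ∈ Finset.range n, x (τ (i + 1)) * (1 / (T - (τ (i + 1) : ℝ)) - 1 / (T - (τ i : ℝ))) =
      ∫ u in Set.Ioc (time0 hT) t, rightStep x n τ u * (1 / (T - (u : ℝ)) ^ 2) := by
  have hle : ∀ i ≤ n, τ i ≤ t := fun i hi => hτ.last ▸ hτ.mono hi
  simp only [rightStep, Finset.sum_mul]
  rw [integral_finsetSum]
  · refine Finset.sum_congr rfl fun i hi => ?_
    have hin := Finset.mem_range.1 hi
    have hlt : (τ (i + 1) : ℝ) < T := lt_of_le_of_lt (Subtype.coe_le_coe.2 (hle (i + 1) hin)) ht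
    rw [← integral_inv_sq (τ i) (τ (i + 1)) (hτ.mono (Nat.le_succ i)) hlt, ← integral_const_mul]
    have e : ∀ u : TimeSet T, (Set.Ioc (τ i) (τ (i + 1))).indicator (fun _ => x (τ (i + 1))) u *
        (1 / (T - (u : ℝ)) ^ 2) = (Set.Ioc (τ i) (τ (i + 1))).indicator
          (fun u => x (τ (i + 1)) * (1 / (T - (u : ℝ)) ^ 2)) u := by
      intro u
      by_cases hu : u ∈ Set.Ioc (τ i) (τ (i + 1)) <;> simp [hu]
    simp only [e]
    rw [setIntegral_indicator measurableSet_Ioc, Set.inter_eq_right.2]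
    exact Set.Ioc_subset_Ioc (time0_le hT _) (hle _ hin)
  · intro i hi
    exact integrableOn_mul_inv_sq (C := C) (measurable_const.indicator measurableSet_Ioc) (by
      intro u
      by_cases hu : u ∈ Set.Ioc (τ i) (τ (i + 1))
      · simpa [hu] using hC _
      · simpa [hu] using (abs_nonneg _).trans (hC u)) ht measurableSet_Ioc Set.Ioc_subset_Iic_self

/-- After summation by parts the kernel increments are integrals of `1/(T-u)²`, so the sum is an
integral of `rightStep`. As the mesh shrinks, the right endpoint of the cell of `u` tends to `u`
from the right; dominated convergence applies because `t < T`. -/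
theorem tendsto_itoSum_kernelPath (hC : ∀ t, |x t| ≤ C)
    (hrc : ∀ t, ContinuousWithinAt x (Set.Ici t) t) (hT : 0 < T)
    {t : TimeSet T} (ht : (t : ℝ) < T) {n : ℕ → ℕ} {τ : ℕ → ℕ → TimeSet T}
    (hτ : ∀ k, IsPartition hT t (n k) (τ k))
    (hmesh : ∀ ε : ℝ, 0 < ε → ∀ᶠ k in atTop, ∀ i < n k, ((τ k (i + 1) : ℝ) - (τ k i : ℝ)) < ε) :
    Tendsto (fun k => ∑ i ∈ Finset.range (n k),
      1 / (T - (τ k i : ℝ)) * (x (τ k (i + 1)) - x (τ k i))) atTop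
      (𝓝 (kernelPath x t - x (time0 hT) / T)) := by
  have e : ∀ k, ∑ i ∈ Finset.range (n k), 1 / (T - (τ k i : ℝ)) * (x (τ k (i + 1)) - x (τ k i)) =
      x t / (T - t) - x (time0 hT) / T -
        ∫ u in Set.Ioc (time0 hT) t, rightStep x (n k) (τ k) u * (1 / (T - (u : ℝ)) ^ 2) := by
    intro k
    rw [itoSum_eq (fun u => 1 / (T - (u : ℝ))), ← sum_mul_sub_eq_integral hC hT ht (hτ k),
      (hτ k).last, (hτ k).first]
    have : ((time0 hT : TimeSet T) : ℝ) = 0 := rfl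
    rw [this]
    ring
  simp only [e]
  have e2 : kernelPath x t - x (time0 hT) / T = x t / (T - t) - x (time0 hT) / T -
      ∫ u in Set.Ioc (time0 hT) t, x u * (1 / (T - (u : ℝ)) ^ 2) := by
    rw [kernelPath, setIntegral_congr_set (Iic_time_ae_eq_Ioc hT t)]
    ring
  rw [e2]
  refine Tendsto.const_sub _ ?_
  refine tendsto_integral_of_dominated_convergence (fun _ => C * (1 / (T - (t : ℝ)) ^ 2)) ?_ ?_ ?_ ?_
  · exact fun k => ((measurable_rightStep _ _).mul measurable_inv_sq).aestronglyMeasurable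
  · exact integrable_const _
  · intro k
    filter_upwards [ae_restrict_mem measurableSet_Ioc] with u hu
    obtain ⟨i, _, _, _, h⟩ := exists_rightStep_eq (x := x) (n := n k) (hτ k).mono
      (by rw [(hτ k).first]; exact hu.1) (by rw [(hτ k).last]; exact hu.2)
    rw [h, norm_mul, Real.norm_eq_abs, Real.norm_of_nonneg (by positivity)]
    exact mul_le_mul (hC _) (inv_sq_le u t hu.2 ht) (by positivity) ((abs_nonneg _).trans (hC u))
  · filter_upwards [ae_restrict_mem measurableSet_Ioc] with u hu
    refine Tendsto.mul_const _ ?_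
    rw [Metric.tendsto_nhds]
    intro ε hε
    obtain ⟨δ, hδ, hball⟩ := Metric.mem_nhdsWithin_iff.1
      ((hrc u).tendsto (Metric.ball_mem_nhds (x u) hε))
    filter_upwards [hmesh δ hδ] with k hk
    obtain ⟨i, hi, h1, h2, h⟩ := exists_rightStep_eq (x := x) (n := n k) (hτ k).mono
      (by rw [(hτ k).first]; exact hu.1) (by rw [(hτ k).last]; exact hu.2)
    rw [h]
    refine hball ⟨?_, h2⟩
    have h1' : (τ k i : ℝ) < u := h1
    have h2' : (u : ℝ) ≤ τ k (i + 1) := h2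
    have := hk i hi
    rw [Metric.mem_ball, Subtype.dist_eq, Real.dist_eq, abs_lt]
    constructor <;> linarith

theorem kernelPath_sub (hx : Measurable x) (hC : ∀ t, |x t| ≤ C) {s t : TimeSet T} (hst : s ≤ t)
    (ht : (t : ℝ) < T) : kernelPath x t - kernelPath x s = x t / (T - t) - x s / (T - s) -
      ∫ u in Set.Ioc s t, x u * (1 / (T - (u : ℝ)) ^ 2) := by
  have h : (Set.Iic t : Set (TimeSet T)) = Set.Iic s ∪ Set.Ioc s t :=
    (Set.Iic_union_Ioc_eq_Iic hst).symm
  rw [kernelPath, kernelPath, h, setIntegral_union (Set.Iic_disjoint_Ioc le_rfl) measurableSet_Ioc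
    (integrableOn_mul_inv_sq hx hC ht measurableSet_Iic (Set.Iic_subset_Iic.2 hst))
    (integrableOn_mul_inv_sq hx hC ht measurableSet_Ioc Set.Ioc_subset_Iic_self)]
  ring

theorem continuousAt_integral_inv_sq (hx : Measurable x) (hC : ∀ t, |x t| ≤ C) {t : TimeSet T}
    (ht : (t : ℝ) < T) :
    ContinuousAt (fun s => ∫ u in Set.Iic s, x u * (1 / (T - (u : ℝ)) ^ 2)) t := by
  obtain ⟨v, hv1, hv2⟩ := exists_between ht
  have hv0 : 0 ≤ v := t.2.1.trans hv1.le
  set w : TimeSet T := ⟨v, hv0, hv2.le⟩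
  have htw : t < w := hv1
  have hwT : (w : ℝ) < T := hv2
  have hev : ∀ᶠ s in 𝓝 t, s < w := gt_mem_nhds htw
  have e : ∀ s : TimeSet T, ∫ u in Set.Iic s, x u * (1 / (T - (u : ℝ)) ^ 2) =
      ∫ u, (Set.Iic s).indicator (fun u => x u * (1 / (T - (u : ℝ)) ^ 2)) u :=
    fun s => (integral_indicator measurableSet_Iic).symm
  simp only [e]
  refine tendsto_integral_filter_of_dominated_convergence
    (fun _ => C * (1 / (T - (w : ℝ)) ^ 2)) ?_ ?_ ?_ ?_
  · exact Eventually.of_forall fun s =>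
      ((hx.mul measurable_inv_sq).indicator measurableSet_Iic).aestronglyMeasurable
  · filter_upwards [hev] with s hs
    refine Eventually.of_forall fun u => ?_
    by_cases hu : u ∈ Set.Iic s
    · rw [Set.indicator_of_mem hu, norm_mul, Real.norm_eq_abs, Real.norm_of_nonneg (by positivity)]
      exact mul_le_mul (hC u) (inv_sq_le u w (le_trans hu hs.le) hwT) (by positivity)
        ((abs_nonneg _).trans (hC u))
    · rw [Set.indicator_of_notMem hu, norm_zero]
      exact mul_nonneg ((abs_nonneg _).trans (hC u)) (by positivity)
  · exact integrable_const _
  · have hne : ∀ᵐ u : TimeSet T, u ≠ t := by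
      rw [ae_iff]; simp
    filter_upwards [hne] with u hu
    refine tendsto_const_nhds.congr' ?_
    rcases lt_or_gt_of_ne hu with h | h
    · filter_upwards [lt_mem_nhds h] with s hs
      rw [Set.indicator_of_mem (Set.mem_Iic.2 h.le), Set.indicator_of_mem (Set.mem_Iic.2 hs.le)]
    · filter_upwards [gt_mem_nhds h] with s hs
      rw [Set.indicator_of_notMem (by simpa using h), Set.indicator_of_notMem (by simpa using hs)]

theorem isRCLLAt_kernelPath (hx : Measurable x) (hC : ∀ t, |x t| ≤ C) {t : TimeSet T}
    (hxt : IsRCLLAt x t) (ht : (t : ℝ) < T) : IsRCLLAt (kernelPath x) t := by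
  have hc := continuousAt_integral_inv_sq hx hC ht
  have hd : ContinuousAt (fun s : TimeSet T => T - (s : ℝ)) t := by fun_prop
  have hne : T - (t : ℝ) ≠ 0 := by linarith
  refine ⟨(hxt.1.div hd.continuousWithinAt hne).sub hc.continuousWithinAt, ?_⟩
  obtain ⟨l, hl⟩ := hxt.2
  exact ⟨_, (hl.div (hd.tendsto.mono_left nhdsWithin_le_nhds) hne).sub
    (hc.tendsto.mono_left nhdsWithin_le_nhds)⟩

/-- `∫₀ᵗ K u du = x t - (T - t) K t` for `K = kernelPath x`. -/
theorem integral_kernelPath (hx : Measurable x) (hC : ∀ t, |x t| ≤ C) {t : TimeSet T}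
    (ht : (t : ℝ) < T) : ∫ u in Set.Iic t, kernelPath x u = x t - (T - t) * kernelPath x t := by
  set c : TimeSet T → ℝ := fun u => x u * (1 / (T - (u : ℝ)) ^ 2) with hc
  have hcm : Measurable c := hx.mul measurable_inv_sq
  have hCn : 0 ≤ C := (abs_nonneg _).trans (hC t)
  have hcb : ∀ u ≤ t, |c u| ≤ C * (1 / (T - (t : ℝ)) ^ 2) := by
    intro u hu
    rw [hc, abs_mul, abs_of_nonneg (a := 1 / (T - (u : ℝ)) ^ 2) (by positivity)]
    exact mul_le_mul (hC u) (inv_sq_le u t hu ht) (by positivity) hCn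
  have hint0 := integrableOn_mul_inv_sq hx hC ht measurableSet_Iic (le_refl (Set.Iic t))
  -- Fubini on the triangle `v ≤ u ≤ t`: the slice at fixed `v` has length `t - v`.
  set F : TimeSet T × TimeSet T → ℝ := fun p => {p : TimeSet T × TimeSet T | p.2 ≤ p.1}.indicator
    (fun p => c p.2) p with hF
  have hFm : Measurable F :=
    (hcm.comp measurable_snd).indicator (measurableSet_le measurable_snd measurable_fst)
  have hFint : Integrable F ((volume.restrict (Set.Iic t)).prod (volume.restrict (Set.Iic t))) := by
    refine Integrable.of_bound hFm.aestronglyMeasurable (C * (1 / (T - (t : ℝ)) ^ 2)) ?_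
    rw [Measure.prod_restrict]
    filter_upwards [ae_restrict_mem (measurableSet_Iic.prod measurableSet_Iic)] with p hp
    rw [Real.norm_eq_abs, hF]
    by_cases h : p ∈ {p : TimeSet T × TimeSet T | p.2 ≤ p.1}
    · simp only [Set.indicator_of_mem h]
      exact hcb _ hp.2
    · simp only [Set.indicator_of_notMem h, abs_zero]
      positivity
  have hinner : ∀ u ∈ Set.Iic t, ∫ v in Set.Iic u, c v = ∫ v in Set.Iic t, F (u, v) := by
    intro u hu
    have : ∀ v, F (u, v) = (Set.Iic u).indicator c v := fun v => by
      simp only [hF, Set.indicator_apply, Set.mem_ofPred_eq, Set.mem_Iic]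
    simp only [this]
    rw [setIntegral_indicator measurableSet_Iic, Set.inter_eq_right.2 (Set.Iic_subset_Iic.2 hu)]
  have hinner2 : ∀ v ∈ Set.Iic t, ∫ u in Set.Iic t, F (u, v) = (t - v) * c v := by
    intro v hv
    have : ∀ u, F (u, v) = (Set.Ici v).indicator (fun _ => c v) u := fun u => by
      simp only [hF, Set.indicator_apply, Set.mem_ofPred_eq, Set.mem_Ici]
    simp only [this]
    rw [setIntegral_indicator measurableSet_Ici, setIntegral_const, smul_eq_mul]
    congr 1
    rw [Set.inter_comm, Set.Ici_inter_Iic, ← measureReal_congr Ioc_ae_eq_Icc]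
    exact volume_Ioc_timeSet v t hv
  have hI : Integrable (fun u : TimeSet T => x u / (T - u)) (volume.restrict (Set.Iic t)) := by
    have h := (hint0.bdd_mul (c := T) (f := fun u : TimeSet T => T - (u : ℝ))
      (measurable_const.sub measurable_subtype_coe).aestronglyMeasurable
      (Eventually.of_forall fun u => by
        rw [Real.norm_of_nonneg (by linarith [u.2.2])]; linarith [u.2.1]))
    refine h.congr ?_
    filter_upwards [ae_restrict_mem measurableSet_Iic] with u hu
    have hu' : (u : ℝ) ≤ t := hu
    have : T - (u : ℝ) ≠ 0 := by linarith
    field_simp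
  have hI2 : Integrable (fun u : TimeSet T => ∫ v in Set.Iic u, c v)
      (volume.restrict (Set.Iic t)) := by
    refine hFint.integral_prod_left.congr ?_
    filter_upwards [ae_restrict_mem measurableSet_Iic] with u hu using (hinner u hu).symm
  have hdef : ∀ u, kernelPath x u = x u / (T - u) - ∫ v in Set.Iic u, c v := fun u => rfl
  simp only [hdef]
  rw [integral_sub hI hI2, setIntegral_congr_fun measurableSet_Iic hinner,
    integral_integral_swap hFint, setIntegral_congr_fun measurableSet_Iic hinner2]
  have hI3 : Integrable (fun v : TimeSet T => (t - v) * c v) (volume.restrict (Set.Iic t)) := by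
    refine hFint.integral_prod_right.congr ?_
    filter_upwards [ae_restrict_mem measurableSet_Iic] with u hu using hinner2 u hu
  rw [← integral_sub hI hI3]
  -- Here `x u / (T - u) = (T - u) * c u`, so the weight `(T - u) - (t - u)` no longer depends on
  -- `u`.
  have e : ∀ u ∈ Set.Iic t, x u / (T - (u : ℝ)) - ((t : ℝ) - u) * c u = (T - t) * c u := by
    intro u hu
    have hu' : (u : ℝ) ≤ t := hu
    have : T - (u : ℝ) ≠ 0 := by linarith
    simp only [hc]
    field_simp
    ring
  rw [setIntegral_congr_fun measurableSet_Iic e, integral_const_mul, mul_sub,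
    mul_div_cancel₀ _ (by linarith : T - (t : ℝ) ≠ 0)]
  ring

end PathwiseIntegral

/-! ### The stochastic integral: existence and identification. -/

section StochasticIntegral

variable {Ω : Type*} {mΩ : MeasurableSpace Ω} {P : Measure Ω} {T : ℝ}
  {ℱ : Filtration (TimeSet T) mΩ} {S M : TimeSet T → Ω → ℝ}

/-- The partition of `[0, t]` into `k + 1` intervals of equal length. -/
noncomputable def uniformPartition (t : TimeSet T) (k i : ℕ) : TimeSet T :=
  ⟨min 1 ((i : ℝ) / (k + 1 : ℕ)) * t, mul_nonneg (le_min zero_le_one (by positivity)) t.2.1,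
    (mul_le_of_le_one_left t.2.1 (min_le_left _ _)).trans t.2.2⟩

theorem isPartition_uniformPartition (hT : 0 < T) (t : TimeSet T) (k : ℕ) :
    IsPartition hT t (k + 1) (uniformPartition t k) where
  mono i j hij := by
    refine Subtype.coe_le_coe.1 (mul_le_mul_of_nonneg_right (min_le_min_left _ ?_) t.2.1)
    gcongr
  first := by
    apply Subtype.ext
    simp [uniformPartition, time0]
  last := by
    apply Subtype.ext
    have : ((k + 1 : ℕ) : ℝ) ≠ 0 := by positivity
    simp only [uniformPartition, div_self this, min_self, one_mul]

theorem uniformPartition_mesh (t : TimeSet T) (ε : ℝ) (hε : 0 < ε) :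
    ∀ᶠ k in atTop, ∀ i < k + 1,
      ((uniformPartition t k (i + 1) : ℝ) - (uniformPartition t k i : ℝ)) < ε := by
  have h : Tendsto (fun k : ℕ => T * (1 / ((k : ℝ) + 1))) atTop (𝓝 0) := by
    simpa using tendsto_one_div_add_atTop_nhds_zero_nat.const_mul T
  filter_upwards [h.eventually (gt_mem_nhds hε)] with k hk i hi
  have h1 : ((i + 1 : ℕ) : ℝ) / (k + 1 : ℕ) ≤ 1 := by
    rw [div_le_one (by positivity)]
    exact_mod_cast hi
  have h2 : (i : ℝ) / (k + 1 : ℕ) ≤ 1 := by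
    rw [div_le_one (by positivity)]
    exact_mod_cast hi.le
  simp only [uniformPartition, min_eq_right h1, min_eq_right h2]
  refine lt_of_le_of_lt ?_ hk
  have e : ((i + 1 : ℕ) : ℝ) / (k + 1 : ℕ) * (t : ℝ) - (i : ℝ) / (k + 1 : ℕ) * t =
      t * (1 / ((k : ℝ) + 1)) := by
    push_cast
    field_simp
    ring
  rw [e]
  exact mul_le_mul_of_nonneg_right t.2.2 (by positivity)

theorem IsPriceMartingale.isProgressive (hM : IsPriceMartingale ℱ P S M) : IsProgressive ℱ M :=
  isProgressive_of_rightContinuous hM.adapted fun ω t _ => (hM.rcll ω t).1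

theorem IsPriceMartingale.measurable_path (hT : 0 < T) (hM : IsPriceMartingale ℱ P S M) (ω : Ω) :
    Measurable fun t => M t ω :=
  (measurable_uncurry_of_isProgressive hT hM.isProgressive).comp measurable_prodMk_right

theorem measurable_itoSum (hT : 0 < T) (hM : IsPriceMartingale ℱ P S M) {t : TimeSet T} {n : ℕ}
    {τ : ℕ → TimeSet T} (hτ : IsPartition hT t n τ) : Measurable[ℱ t] (itoSum kernel M n τ) := by
  refine @Finset.measurable_fun_sum _ _ _ _ _ _ (ℱ t) _ _ fun i hi => ?_
  have hle : ∀ j ≤ n, τ j ≤ t := fun j hj => hτ.last ▸ hτ.mono hj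
  have hin := Finset.mem_range.1 hi
  exact Measurable.const_mul (Measurable.sub (hM.adapted.measurable_le (hle _ hin))
    (hM.adapted.measurable_le (hle _ hin.le))) _

theorem tendsto_itoSum_of_isPriceMartingale (hT : 0 < T) (hM : IsPriceMartingale ℱ P S M) {t : TimeSet T}
    (ht : (t : ℝ) < T) {n : ℕ → ℕ} {τ : ℕ → ℕ → TimeSet T}
    (hτ : ∀ k, IsPartition hT t (n k) (τ k))
    (hmesh : ∀ ε : ℝ, 0 < ε → ∀ᶠ k in atTop, ∀ i < n k, ((τ k (i + 1) : ℝ) - (τ k i : ℝ)) < ε)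
    (ω : Ω) : Tendsto (fun k => itoSum kernel M (n k) (τ k) ω) atTop
      (𝓝 (kernelPath (fun s => M s ω) t - M (time0 hT) ω / T)) := by
  obtain ⟨C, hC⟩ := exists_bound_of_rcll (hM.rcll ω)
  exact tendsto_itoSum_kernelPath hC (fun s => (hM.rcll ω s).1) hT ht hτ
    hmesh

/-- Adaptedness is read off the Itô sums, each of which uses `M` only up to time `t`. -/
theorem measurable_kernelPath (hT : 0 < T) (hM : IsPriceMartingale ℱ P S M) {t : TimeSet T}
    (ht : (t : ℝ) < T) : Measurable[ℱ t] fun ω => kernelPath (fun s => M s ω) t := by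
  have h : Measurable[ℱ t] fun ω => kernelPath (fun s => M s ω) t - M (time0 hT) ω / T := by
    refine @measurable_of_tendsto_metrizable _ _ (ℱ t) _ _ _ _ _ _
      (fun k => measurable_itoSum hT hM (isPartition_uniformPartition hT t k)) ?_
    rw [tendsto_pi_nhds]
    exact tendsto_itoSum_of_isPriceMartingale hT hM ht (isPartition_uniformPartition hT t) (uniformPartition_mesh t)
  have h0 : Measurable[ℱ t] fun ω => M (time0 hT) ω / T :=
    (hM.adapted.measurable_le (time0_le hT t)).div_const _
  have e : (fun ω => kernelPath (fun s => M s ω) t) = (fun ω => kernelPath (fun s => M s ω) t -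
      M (time0 hT) ω / T) + fun ω => M (time0 hT) ω / T := by
    ext ω; simp
  rw [e]
  exact h.add h0

theorem exists_isStochasticIntegral [IsFiniteMeasure P] (hT : 0 < T)
    (hM : IsPriceMartingale ℱ P S M) : ∃ N, IsStochasticIntegral hT ℱ P kernel M N := by
  refine ⟨fun t ω => kernelPath (fun s => M s ω) t - M (time0 hT) ω / T, ?_, ?_, ?_⟩
  · exact fun t ht => (measurable_kernelPath hT hM ht).sub
      ((hM.adapted.measurable_le (time0_le hT t)).div_const _)
  · intro ω t ht
    obtain ⟨C, hC⟩ := exists_bound_of_rcll (hM.rcll ω)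
    obtain ⟨h1, l, h2⟩ := isRCLLAt_kernelPath (hM.measurable_path hT ω) hC (hM.rcll ω t) ht
    exact ⟨h1.sub continuousWithinAt_const, _, h2.sub tendsto_const_nhds⟩
  · intro t ht n τ hτ hmesh
    refine tendstoInMeasure_of_tendsto_ae (fun k => ?_) (Eventually.of_forall ?_)
    · exact ((measurable_itoSum hT hM (hτ k)).mono (ℱ.le t) le_rfl).aestronglyMeasurable
    · exact tendsto_itoSum_of_isPriceMartingale hT hM ht hτ hmesh

/-- The Itô sums along uniform partitions converge in probability to `N t`, and at every `ω` to the
pathwise formula; limits in measure are almost surely unique. Every later statement about `N` passes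
through this identity. -/
theorem IsStochasticIntegral.ae_eq_kernelPath [IsFiniteMeasure P] {hT : 0 < T}
    {N : TimeSet T → Ω → ℝ} (hN : IsStochasticIntegral hT ℱ P kernel M N)
    (hM : IsPriceMartingale ℱ P S M) {t : TimeSet T} (ht : (t : ℝ) < T) :
    ∀ᵐ ω ∂P, N t ω = kernelPath (fun s => M s ω) t - M (time0 hT) ω / T := by
  have hp := isPartition_uniformPartition hT t
  have h1 := hN.tendsto_itoSum t ht _ _ hp (uniformPartition_mesh t)
  have h2 : TendstoInMeasure P (fun k => itoSum kernel M (k + 1) (uniformPartition t k)) atTop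
      fun ω => kernelPath (fun s => M s ω) t - M (time0 hT) ω / T :=
    tendstoInMeasure_of_tendsto_ae
      (fun k => ((measurable_itoSum hT hM (hp k)).mono (ℱ.le t) le_rfl).aestronglyMeasurable)
      (Eventually.of_forall (tendsto_itoSum_of_isPriceMartingale hT hM ht hp (uniformPartition_mesh t)))
  exact tendstoInMeasure_ae_unique h1 h2

end StochasticIntegral

/-! ### The Hilbert space `L²(dt ⊗ P)`. -/

section SquareIntegrable

variable {Ω : Type*} {mΩ : MeasurableSpace Ω} {P : Measure Ω} {T : ℝ}
  {f g : TimeSet T → Ω → ℝ}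

/-- `f` is square integrable for `dt ⊗ P`. -/
abbrev SqIntegrable (P : Measure Ω) (f : TimeSet T → Ω → ℝ) : Prop :=
  MemLp (fun p : TimeSet T × Ω => f p.1 p.2) 2 (volume.prod P)

/-- `E ∫₀ᵀ f g dt`. -/
noncomputable def pairing (P : Measure Ω) (f g : TimeSet T → Ω → ℝ) : ℝ :=
  ∫ p : TimeSet T × Ω, f p.1 p.2 * g p.1 p.2 ∂(volume.prod P)

theorem SqIntegrable.integrable_mul (hf : SqIntegrable P f) (hg : SqIntegrable P g) :
    Integrable (fun p : TimeSet T × Ω => f p.1 p.2 * g p.1 p.2) (volume.prod P) :=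
  MemLp.integrable_mul hf hg

theorem pairing_self_nonneg : 0 ≤ pairing P f f := integral_nonneg fun _ => mul_self_nonneg _

theorem SqIntegrable.sub_sq (hf : SqIntegrable P f) (hg : SqIntegrable P g) :
    pairing P (fun t ω => f t ω - g t ω) (fun t ω => f t ω - g t ω) =
      pairing P f f - 2 * pairing P f g + pairing P g g := by
  have e : ∀ p : TimeSet T × Ω, (f p.1 p.2 - g p.1 p.2) * (f p.1 p.2 - g p.1 p.2) =
      f p.1 p.2 * f p.1 p.2 - 2 * (f p.1 p.2 * g p.1 p.2) + g p.1 p.2 * g p.1 p.2 :=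
    fun p => by ring
  have h1 := hf.integrable_mul hf
  have h2 := (hf.integrable_mul hg).const_mul 2
  have h12 : Integrable (fun p : TimeSet T × Ω =>
      f p.1 p.2 * f p.1 p.2 - 2 * (f p.1 p.2 * g p.1 p.2)) (volume.prod P) := h1.sub h2
  simp only [pairing, e]
  rw [integral_add h12 (hg.integrable_mul hg), integral_sub h1 h2, integral_const_mul]

theorem SqIntegrable.indicator (hf : SqIntegrable P f) {A : Set (TimeSet T)}
    (hA : MeasurableSet A) : SqIntegrable P fun t ω => A.indicator (fun s => f s ω) t :=
  (MemLp.indicator (measurable_fst hA) hf).ae_eq (Eventually.of_forall fun p => by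
    by_cases h : p.1 ∈ A <;> simp [Set.indicator, h])

variable [IsProbabilityMeasure P]

theorem SqIntegrable.ae_slice_path (hf : SqIntegrable P f) :
    ∀ᵐ ω ∂P, MemLp (fun t => f t ω) 2 (volume : Measure (TimeSet T)) := by
  have h1 := hf.integrable_sq.prod_left_ae
  have h2 : ∀ᵐ ω ∂P, AEStronglyMeasurable (fun t => f t ω) (volume : Measure (TimeSet T)) :=
    hf.aestronglyMeasurable.prod_swap.prodMk_left
  filter_upwards [h1, h2] with ω h1 h2
  exact (memLp_two_iff_integrable_sq h2).2 h1

theorem SqIntegrable.ae_slice_time (hf : SqIntegrable P f) :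
    ∀ᵐ t : TimeSet T, MemLp (f t) 2 P := by
  have h1 := hf.integrable_sq.prod_right_ae
  have h2 : ∀ᵐ t : TimeSet T, AEStronglyMeasurable (fun ω => f t ω) P :=
    hf.aestronglyMeasurable.prodMk_left
  filter_upwards [h1, h2] with t h1 h2
  exact (memLp_two_iff_integrable_sq h2).2 h1

theorem sqIntegrable_of_bound (hT : 0 < T) (hf : Measurable fun p : TimeSet T × Ω => f p.1 p.2)
    {B : ℝ} (hB : ∀ᵐ t : TimeSet T, MemLp (f t) 2 P ∧ ∫ ω, f t ω ^ 2 ∂P ≤ B) :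
    SqIntegrable P f ∧ pairing P f f ≤ T * B := by
  have h1 : Integrable (fun p : TimeSet T × Ω => f p.1 p.2 ^ 2) (volume.prod P) := by
    rw [integrable_prod_iff (hf.pow_const 2).aestronglyMeasurable]
    refine ⟨hB.mono fun t ht => ht.1.integrable_sq, ?_⟩
    refine Integrable.of_bound ?_ B ?_
    · exact ((hf.pow_const 2).norm.stronglyMeasurable.integral_prod_right').aestronglyMeasurable
    · filter_upwards [hB] with t ht
      simp only [norm_pow, Real.norm_eq_abs, sq_abs]
      rw [abs_of_nonneg (integral_nonneg fun _ => sq_nonneg _)]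
      exact ht.2
  refine ⟨(memLp_two_iff_integrable_sq hf.aestronglyMeasurable).2 h1, ?_⟩
  have e : pairing P f f = ∫ t, ∫ ω, f t ω ^ 2 ∂P := by
    rw [← integral_prod _ h1]
    simp only [pairing, sq]
  rw [e]
  calc ∫ t, ∫ ω, f t ω ^ 2 ∂P ≤ ∫ _ : TimeSet T, B :=
        integral_mono_ae h1.integral_prod_left (integrable_const _) (hB.mono fun t ht => ht.2)
    _ = T * B := by simp [volume_real_univ_timeSet hT]

/-- Cauchy–Schwarz, from the nonnegative integral over `A` of the squared deviation of `x` from its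
mean on `A`. -/
theorem sq_setIntegral_le {A : Set (TimeSet T)} {x : TimeSet T → ℝ} (hx : MemLp x 2 volume) :
    (∫ u in A, x u) ^ 2 ≤ (volume : Measure (TimeSet T)).real A * ∫ u in A, x u ^ 2 := by
  set v := (volume : Measure (TimeSet T)).real A with hv
  have hx1 : Integrable x (volume.restrict A) := (hx.integrable one_le_two).restrict
  have hx2 : Integrable (fun u => x u ^ 2) (volume.restrict A) := hx.integrable_sq.restrict
  rcases (measureReal_nonneg : 0 ≤ v).eq_or_lt with h0 | h0
  · have : (volume : Measure (TimeSet T)).restrict A = 0 := by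
      rw [Measure.restrict_eq_zero]
      exact (measureReal_eq_zero_iff).1 h0.symm
    simp [this]
  set c := (∫ u in A, x u) / v with hc
  have h : 0 ≤ ∫ u in A, (x u - c) ^ 2 := integral_nonneg fun _ => sq_nonneg _
  have e : ∀ u, (x u - c) ^ 2 = x u ^ 2 - 2 * c * x u + c ^ 2 := fun u => by ring
  simp only [e] at h
  have hx12 : Integrable (fun u => x u ^ 2 - 2 * c * x u) (volume.restrict A) :=
    hx2.sub (hx1.const_mul _)
  rw [integral_add hx12 (integrable_const _), integral_sub hx2 (hx1.const_mul _), integral_const_mul, integral_const, smul_eq_mul] at h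
  have hv' : (volume.restrict A).real (Set.univ : Set (TimeSet T)) = v := by
    rw [measureReal_restrict_apply MeasurableSet.univ, Set.univ_inter]
  rw [hv'] at h
  have hcv : c * v = ∫ u in A, x u := by
    rw [hc, div_mul_cancel₀ _ (show v ≠ 0 from h0.ne')]
  rw [← hcv] at h ⊢
  nlinarith

/-- The factor `volume A` makes integrals over `(t, T]` vanish in `L²(P)` as `t → T`. -/
theorem SqIntegrable.setIntegral (hf : SqIntegrable P f) (A : Set (TimeSet T)) :
    MemLp (fun ω => ∫ u in A, f u ω) 2 P ∧
      ∫ ω, (∫ u in A, f u ω) ^ 2 ∂P ≤ (volume : Measure (TimeSet T)).real A * pairing P f f := by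
  have hm : AEStronglyMeasurable (fun p : TimeSet T × Ω => f p.1 p.2)
      ((volume.restrict A).prod P) := by
    have h := hf.aestronglyMeasurable.restrict (s := A ×ˢ (Set.univ : Set Ω))
    rwa [← Measure.prod_restrict, Measure.restrict_univ] at h
  have hm' : AEStronglyMeasurable (fun ω => ∫ u in A, f u ω) P := hm.prod_swap.integral_prod_right'
  have hint := hf.integrable_sq.integral_prod_right
  have hle : ∀ᵐ ω ∂P, (∫ u in A, f u ω) ^ 2 ≤
      (volume : Measure (TimeSet T)).real A * ∫ u, f u ω ^ 2 := by
    filter_upwards [hf.ae_slice_path] with ω hω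
    refine (sq_setIntegral_le hω).trans ?_
    gcongr
    · exact Eventually.of_forall fun _ => sq_nonneg _
    · exact hω.integrable_sq
    · exact Measure.restrict_le_self
  have hsq : Integrable (fun ω => (∫ u in A, f u ω) ^ 2) P := by
    refine (hint.const_mul ((volume : Measure (TimeSet T)).real A)).mono' (hm'.pow 2) ?_
    filter_upwards [hle] with ω hω
    rw [Real.norm_of_nonneg (sq_nonneg _)]
    exact hω
  refine ⟨(memLp_two_iff_integrable_sq hm').2 hsq, ?_⟩
  refine (integral_mono_ae hsq (hint.const_mul _) hle).trans (le_of_eq ?_)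
  rw [integral_const_mul]
  congr 1
  rw [pairing]
  simp only [← sq]
  exact (integral_prod_symm _ hf.integrable_sq).symm

theorem SqIntegrable.of_const {Z : Ω → ℝ} (hZ : MemLp Z 2 P) :
    SqIntegrable P fun (_ : TimeSet T) ω => Z ω := by
  refine hZ.comp_snd _

theorem SqIntegrable.integral_mul_integral (hf : SqIntegrable P f) {Z : Ω → ℝ}
    (hZ : MemLp Z 2 P) : ∫ ω, Z ω * (∫ u, f u ω) ∂P = ∫ u, ∫ ω, Z ω * f u ω ∂P := by
  simp only [← integral_const_mul]
  exact (integral_integral_swap (f := fun u ω => Z ω * f u ω)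
    ((SqIntegrable.of_const hZ).integrable_mul hf)).symm

end SquareIntegrable

/-! ### The process `K`: martingale property, norm bound, orthogonality and total integral. -/

section KernelProcess

variable {Ω : Type*} {mΩ : MeasurableSpace Ω} {P : Measure Ω} {T : ℝ}
  {ℱ : Filtration (TimeSet T) mΩ} {S M : TimeSet T → Ω → ℝ}

/-- The process `M₀ / T + ∫₀ᵗ dM_u / (T - u)` in its integrated by parts form, zero at time `T`. -/
noncomputable def kernelProcess (M : TimeSet T → Ω → ℝ) (t : TimeSet T) (ω : Ω) : ℝ :=
  if (t : ℝ) < T then kernelPath (fun s => M s ω) t else 0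

theorem kernelProcess_of_lt {t : TimeSet T} (ht : (t : ℝ) < T) (ω : Ω) :
    kernelProcess M t ω = kernelPath (fun s => M s ω) t := if_pos ht

theorem adapted_kernelProcess (hT : 0 < T) (hM : IsPriceMartingale ℱ P S M) :
    Adapted ℱ (kernelProcess M) := by
  intro t
  by_cases ht : (t : ℝ) < T
  · rw [show kernelProcess M t = fun ω => kernelPath (fun s => M s ω) t from
      funext (kernelProcess_of_lt ht)]
    exact measurable_kernelPath hT hM ht
  · rw [show kernelProcess M t = fun _ => (0 : ℝ) from funext fun _ => if_neg ht]
    exact measurable_const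

theorem isProgressive_kernelProcess (hT : 0 < T) (hM : IsPriceMartingale ℱ P S M) :
    IsProgressive ℱ (kernelProcess M) := by
  refine isProgressive_of_rightContinuous (adapted_kernelProcess hT hM) fun ω t ht => ?_
  obtain ⟨C, hC⟩ := exists_bound_of_rcll (hM.rcll ω)
  refine (isRCLLAt_kernelPath (hM.measurable_path hT ω) hC (hM.rcll ω t) ht).1.congr_of_eventuallyEq
    ?_ (kernelProcess_of_lt ht ω)
  have : ∀ᶠ s : TimeSet T in 𝓝 t, s < timeEnd hT := gt_mem_nhds ht
  filter_upwards [nhdsWithin_le_nhds this] with s hs using kernelProcess_of_lt hs ω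

/-- `kernelProcess` stopped at time `t`. -/
noncomputable def stoppedKernel (M : TimeSet T → Ω → ℝ) (t s : TimeSet T) (ω : Ω) : ℝ :=
  kernelProcess M (min s t) ω

theorem adapted_stoppedKernel (hT : 0 < T) (hM : IsPriceMartingale ℱ P S M) (t : TimeSet T) :
    Adapted ℱ (stoppedKernel M t) :=
  fun s => (adapted_kernelProcess hT hM).measurable_le (min_le_left s t)

theorem measurable_uncurry_stoppedKernel (hT : 0 < T) (hM : IsPriceMartingale ℱ P S M)
    (t : TimeSet T) : Measurable fun p : TimeSet T × Ω => stoppedKernel M t p.1 p.2 :=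
  (measurable_uncurry_of_isProgressive hT (isProgressive_kernelProcess hT hM)).comp
    ((measurable_fst.min measurable_const).prodMk measurable_snd)

theorem integral_eq_add_Ioi (t : TimeSet T) {x : TimeSet T → ℝ} (hx : Integrable x) :
    ∫ u, x u = (∫ u in Set.Iic t, x u) + ∫ u in Set.Ioi t, x u := by
  rw [← integral_add_compl (measurableSet_Iic (a := t)) hx, Set.compl_Iic]

/-- Freezing `K` after `t` contributes `(T - t) K_t`, exactly the term that `integral_kernelPath`
subtracts. -/
theorem integral_stoppedKernel (hT : 0 < T) (hM : IsPriceMartingale ℱ P S M) {t : TimeSet T}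
    (ht : (t : ℝ) < T) {ω : Ω} (hi : Integrable fun s => stoppedKernel M t s ω) :
    ∫ s, stoppedKernel M t s ω = M t ω := by
  obtain ⟨C, hC⟩ := exists_bound_of_rcll (hM.rcll ω)
  have e1 : ∀ s ∈ Set.Iic t, stoppedKernel M t s ω = kernelPath (fun s => M s ω) s := by
    intro s hs
    rw [stoppedKernel, min_eq_left hs, kernelProcess_of_lt]
    exact lt_of_le_of_lt (Subtype.coe_le_coe.2 hs) ht
  have e2 : ∀ s ∈ Set.Ioi t, stoppedKernel M t s ω = kernelPath (fun s => M s ω) t := by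
    intro s hs
    rw [stoppedKernel, min_eq_right (le_of_lt hs), kernelProcess_of_lt ht]
  rw [integral_eq_add_Ioi t hi, setIntegral_congr_fun measurableSet_Iic e1,
    setIntegral_congr_fun measurableSet_Ioi e2, setIntegral_const, volume_Ioi_timeSet,
    integral_kernelPath (hM.measurable_path hT ω) hC ht, smul_eq_mul]
  ring

theorem integral_sub_sq {Y Z : Ω → ℝ} (hY : MemLp Y 2 P) (hZ : MemLp Z 2 P) :
    ∫ ω, (Y ω - Z ω) ^ 2 ∂P =
      ∫ ω, Y ω ^ 2 ∂P - 2 * ∫ ω, Y ω * Z ω ∂P + ∫ ω, Z ω ^ 2 ∂P := by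
  have e : ∀ ω, (Y ω - Z ω) ^ 2 = Y ω ^ 2 - 2 * (Y ω * Z ω) + Z ω ^ 2 := fun ω => by ring
  have h2 : Integrable (fun ω => 2 * (Y ω * Z ω)) P := (MemLp.integrable_mul hY hZ).const_mul 2
  have h12 : Integrable (fun ω => Y ω ^ 2 - 2 * (Y ω * Z ω)) P := hY.integrable_sq.sub h2
  simp only [e]
  rw [integral_add h12 hZ.integrable_sq, integral_sub hY.integrable_sq h2, integral_const_mul]

/-- Pythagoras: `Y - Z` is orthogonal to `Z`. -/
theorem integral_sq_le_of_integral_mul_eq {Y Z : Ω → ℝ} (hY : MemLp Y 2 P) (hZ : MemLp Z 2 P)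
    (h : ∫ ω, Y ω * Z ω ∂P = ∫ ω, Z ω ^ 2 ∂P) : ∫ ω, Z ω ^ 2 ∂P ≤ ∫ ω, Y ω ^ 2 ∂P := by
  have h1 := integral_sub_sq hY hZ
  have h2 : 0 ≤ ∫ ω, (Y ω - Z ω) ^ 2 ∂P := integral_nonneg fun _ => sq_nonneg _
  linarith

theorem sqIntegrable_indicator_weight {f : TimeSet T → Ω → ℝ} (hf : SqIntegrable P f)
    {t : TimeSet T} (ht : (t : ℝ) < T) {A : Set (TimeSet T)} (hA : MeasurableSet A)
    (hAt : A ⊆ Set.Iic t) :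
    SqIntegrable P fun u ω => A.indicator (fun u => f u ω * (1 / (T - (u : ℝ)) ^ 2)) u := by
  have hind : Measurable (A.indicator fun u : TimeSet T => 1 / (T - (u : ℝ)) ^ 2) :=
    measurable_inv_sq.indicator hA
  have e : ∀ u ω, A.indicator (fun u => f u ω * (1 / (T - (u : ℝ)) ^ 2)) u =
      A.indicator (fun u : TimeSet T => 1 / (T - (u : ℝ)) ^ 2) u * f u ω := by
    intro u ω
    by_cases hu : u ∈ A <;> simp [hu, mul_comm]
  simp only [e]
  refine MemLp.of_le_mul (c := 1 / (T - (t : ℝ)) ^ 2) hf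
    ((hind.comp measurable_fst).aestronglyMeasurable.mul hf.aestronglyMeasurable) ?_
  refine Eventually.of_forall fun p => ?_
  rw [norm_mul]
  refine mul_le_mul_of_nonneg_right ?_ (norm_nonneg _)
  by_cases hu : p.1 ∈ A
  · rw [Set.indicator_of_mem hu, Real.norm_of_nonneg (by positivity)]
    exact inv_sq_le _ _ (hAt hu) ht
  · rw [Set.indicator_of_notMem hu, norm_zero]
    positivity

theorem SqIntegrable.sub_sq_le {f g : TimeSet T → Ω → ℝ} (hf : SqIntegrable P f)
    (hg : SqIntegrable P g) : pairing P (fun t ω => f t ω - g t ω) (fun t ω => f t ω - g t ω) ≤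
      2 * pairing P f f + 2 * pairing P g g := by
  have hfi := hf.integrable_mul hf
  have hgi := hg.integrable_mul hg
  have hi := (MemLp.sub hf hg).integrable_mul (MemLp.sub hf hg)
  have e := integral_mono hi ((hfi.const_mul 2).add (hgi.const_mul 2)) fun p => by
    simp only [Pi.mul_apply, Pi.sub_apply, Pi.add_apply]
    nlinarith [mul_self_nonneg (f p.1 p.2 + g p.1 p.2)]
  have e2 := integral_add (hfi.const_mul 2) (hgi.const_mul 2)
  rw [integral_const_mul, integral_const_mul] at e2
  exact e.trans_eq e2

theorem tendsto_pairing_Ioi (hT : 0 < T) {t : ℕ → TimeSet T}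
    (ht : Tendsto t atTop (𝓝 (timeEnd hT))) {ψ : TimeSet T → Ω → ℝ} (hψ : SqIntegrable P ψ) :
    Tendsto (fun n => ∫ p : TimeSet T × Ω, (Set.Ioi (t n) ×ˢ Set.univ).indicator
      (fun p => ψ p.1 p.2 * ψ p.1 p.2) p ∂(volume.prod P)) atTop (𝓝 0) := by
  have hi := hψ.integrable_mul hψ
  suffices h0 : Tendsto (fun n => ∫ p : TimeSet T × Ω, (Set.Ioi (t n) ×ˢ Set.univ).indicator
      (fun p => ψ p.1 p.2 * ψ p.1 p.2) p ∂(volume.prod P)) atTop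
      (𝓝 (∫ _ : TimeSet T × Ω, (0 : ℝ) ∂(volume.prod P))) by
    simpa only [integral_zero] using h0
  refine tendsto_integral_of_dominated_convergence (fun p => ψ p.1 p.2 * ψ p.1 p.2) ?_ hi ?_ ?_
  · exact fun n => hi.aestronglyMeasurable.indicator (measurableSet_Ioi.prod MeasurableSet.univ)
  · intro n
    refine Eventually.of_forall fun p => ?_
    refine (norm_indicator_le_norm_self _ _).trans_eq ?_
    rw [Real.norm_of_nonneg (mul_self_nonneg _)]
  · have hlt : ∀ᵐ p : TimeSet T × Ω ∂(volume.prod P), (p.1 : ℝ) < T :=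
      Measure.quasiMeasurePreserving_fst.ae ae_lt_timeSet
    filter_upwards [hlt] with p hp
    refine tendsto_const_nhds.congr' ?_
    have hs' : p.1 < timeEnd hT := hp
    filter_upwards [ht.eventually (lt_mem_nhds hs')] with n hn
    rw [Set.indicator_of_notMem]
    rintro ⟨h, -⟩
    exact absurd hn (not_lt.2 (le_of_lt h))

variable [IsProbabilityMeasure P]

theorem SqIntegrable.integral {f : TimeSet T → Ω → ℝ} (hf : SqIntegrable P f) :
    MemLp (fun ω => ∫ u, f u ω) 2 P := by
  simpa using (hf.setIntegral Set.univ).1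

theorem IsPriceMartingale.memLp (hM : IsPriceMartingale ℱ P S M) (hS : SqIntegrable P S)
    (t : TimeSet T) : MemLp (M t) 2 P :=
  (hS.integral.condExp one_le_two).ae_eq (hM.eq_condExp t).symm

/-- The factor `Z` is known at time `t` and passes through the conditional expectation. -/
theorem IsPriceMartingale.integral_mul (hM : IsPriceMartingale ℱ P S M) (hS : SqIntegrable P S)
    {t : TimeSet T} {Z : Ω → ℝ} (hZm : Measurable[ℱ t] Z) (hZ : MemLp Z 2 P) :
    ∫ ω, Z ω * M t ω ∂P = ∫ ω, Z ω * (∫ u, S u ω) ∂P := by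
  have hX := hS.integral
  have h := condExp_mul_of_stronglyMeasurable_left (μ := P) (m := ℱ t) (f := Z)
    (g := fun ω => ∫ u, S u ω) hZm.stronglyMeasurable (MemLp.integrable_mul hZ hX)
    (hX.integrable one_le_two)
  calc ∫ ω, Z ω * M t ω ∂P = ∫ ω, (P[Z * (fun ω => ∫ u, S u ω) | ℱ t]) ω ∂P := by
        refine integral_congr_ae ?_
        filter_upwards [h, hM.eq_condExp t] with ω h1 h2
        rw [h1, Pi.mul_apply, h2]
    _ = _ := by rw [integral_condExp (ℱ.le t)]; rfl

theorem IsPriceMartingale.integral_sq_le (hM : IsPriceMartingale ℱ P S M) (hS : SqIntegrable P S)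
    (t : TimeSet T) : ∫ ω, M t ω ^ 2 ∂P ≤ ∫ ω, (∫ u, S u ω) ^ 2 ∂P := by
  refine integral_sq_le_of_integral_mul_eq hS.integral (hM.memLp hS t) ?_
  have h := hM.integral_mul hS (hM.adapted t) (hM.memLp hS t)
  simp only [sq, h, mul_comm]

theorem IsPriceMartingale.sqIntegrable (hT : 0 < T) (hM : IsPriceMartingale ℱ P S M)
    (hS : SqIntegrable P S) : SqIntegrable P M :=
  (sqIntegrable_of_bound hT (measurable_uncurry_of_isProgressive hT hM.isProgressive)
    (Eventually.of_forall fun t => ⟨hM.memLp hS t, hM.integral_sq_le hS t⟩)).1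

theorem memLp_kernelProcess (hT : 0 < T) (hM : IsPriceMartingale ℱ P S M) (hS : SqIntegrable P S)
    (t : TimeSet T) : MemLp (kernelProcess M t) 2 P := by
  by_cases ht : (t : ℝ) < T
  swap
  · have : kernelProcess M t = fun _ => (0 : ℝ) := funext fun ω => if_neg ht
    rw [this]
    exact MemLp.zero'
  have h := (sqIntegrable_indicator_weight (hM.sqIntegrable hT hS) ht measurableSet_Iic
    (le_refl (Set.Iic t))).integral
  simp only [integral_indicator measurableSet_Iic] at h
  have h2 := ((hM.memLp hS t).const_mul (1 / (T - (t : ℝ)))).sub h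
  refine h2.ae_eq (Eventually.of_forall fun ω => ?_)
  rw [kernelProcess_of_lt ht, kernelPath]
  simp only [Pi.sub_apply]
  ring

/-- The martingale property of `kernelProcess`, tested against square integrable variables. -/
theorem integral_mul_kernelProcess (hT : 0 < T) (hM : IsPriceMartingale ℱ P S M)
    (hS : SqIntegrable P S) {s t : TimeSet T} (hst : s ≤ t) (ht : (t : ℝ) < T) {Z : Ω → ℝ}
    (hZm : Measurable[ℱ s] Z) (hZ : MemLp Z 2 P) :
    ∫ ω, Z ω * kernelProcess M t ω ∂P = ∫ ω, Z ω * kernelProcess M s ω ∂P := by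
  have hs : (s : ℝ) < T := lt_of_le_of_lt (Subtype.coe_le_coe.2 hst) ht
  have hX := fun {u : TimeSet T} (hu : s ≤ u) =>
    hM.integral_mul hS (hZm.mono (ℱ.mono hu) le_rfl) hZ
  set f : TimeSet T → Ω → ℝ := fun u ω =>
    (Set.Ioc s t).indicator (fun u => M u ω * (1 / (T - (u : ℝ)) ^ 2)) u with hf
  have hfs : SqIntegrable P f := sqIntegrable_indicator_weight (hM.sqIntegrable hT hS) ht
    measurableSet_Ioc Set.Ioc_subset_Iic_self
  have hdiff : ∀ ω, Z ω * kernelProcess M t ω - Z ω * kernelProcess M s ω =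
      1 / (T - t) * (Z ω * M t ω) - 1 / (T - s) * (Z ω * M s ω) - Z ω * ∫ u, f u ω := by
    intro ω
    obtain ⟨C, hC⟩ := exists_bound_of_rcll (hM.rcll ω)
    rw [← mul_sub, kernelProcess_of_lt ht, kernelProcess_of_lt hs,
      kernelPath_sub (hM.measurable_path hT ω) hC hst ht, hf, integral_indicator measurableSet_Ioc]
    ring
  -- For `u ≥ s` the value `E[Z M_u]` is the constant `E[Z X]`, so the weight `1/(T-u)²` integrates
  -- to the difference of the two boundary coefficients and everything cancels.
  have hfub : ∫ ω, Z ω * (∫ u, f u ω) ∂P =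
      (1 / (T - t) - 1 / (T - s)) * ∫ ω, Z ω * (∫ u, S u ω) ∂P := by
    rw [hfs.integral_mul_integral hZ, ← integral_inv_sq s t hst ht, ← integral_mul_const,
      ← integral_indicator measurableSet_Ioc]
    congr 1
    ext u
    by_cases hu : u ∈ Set.Ioc s t
    · simp only [hf, Set.indicator_of_mem hu]
      rw [← hX hu.1.le, ← integral_const_mul]
      congr 1
      ext ω
      ring
    · simp [hf, Set.indicator_of_notMem hu]
  have i1 := MemLp.integrable_mul hZ (memLp_kernelProcess hT hM hS t)
  have i2 := MemLp.integrable_mul hZ (memLp_kernelProcess hT hM hS s)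
  have i3 : Integrable (fun ω => 1 / (T - t) * (Z ω * M t ω)) P :=
    (MemLp.integrable_mul hZ (hM.memLp hS t)).const_mul _
  have i4 : Integrable (fun ω => 1 / (T - s) * (Z ω * M s ω)) P :=
    (MemLp.integrable_mul hZ (hM.memLp hS s)).const_mul _
  have i34 : Integrable (fun ω => 1 / (T - t) * (Z ω * M t ω) - 1 / (T - s) * (Z ω * M s ω)) P :=
    i3.sub i4
  have i5 : Integrable (fun ω => Z ω * ∫ u, f u ω) P := MemLp.integrable_mul hZ hfs.integral
  rw [← sub_eq_zero]
  have h := integral_sub i1 i2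
  simp only [Pi.mul_apply] at h
  rw [← h]
  simp only [hdiff]
  rw [integral_sub i34 i5, integral_sub i3 i4, integral_const_mul, integral_const_mul, hX hst,
    hX le_rfl, hfub]
  ring

theorem integral_kernelProcess_sq_mono (hT : 0 < T) (hM : IsPriceMartingale ℱ P S M)
    (hS : SqIntegrable P S) {s t : TimeSet T} (hst : s ≤ t) (ht : (t : ℝ) < T) :
    ∫ ω, kernelProcess M s ω ^ 2 ∂P ≤ ∫ ω, kernelProcess M t ω ^ 2 ∂P := by
  have hK := memLp_kernelProcess hT hM hS
  refine integral_sq_le_of_integral_mul_eq (hK t) (hK s) ?_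
  have h := integral_mul_kernelProcess hT hM hS hst ht (adapted_kernelProcess hT hM s) (hK s)
  simp only [sq, ← h, mul_comm]

theorem sqIntegrable_stoppedKernel (hT : 0 < T) (hM : IsPriceMartingale ℱ P S M)
    (hS : SqIntegrable P S) {t : TimeSet T} (ht : (t : ℝ) < T) :
    SqIntegrable P (stoppedKernel M t) :=
  (sqIntegrable_of_bound hT (measurable_uncurry_stoppedKernel hT hM t)
    (Eventually.of_forall fun s => ⟨memLp_kernelProcess hT hM hS (min s t),
      integral_kernelProcess_sq_mono hT hM hS (min_le_right s t) ht⟩)).1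

/-- For `s ≤ t` the martingale property replaces `K_t` by `K_s` against the `ℱ s`-measurable `ψ_s`;
for `s ≥ t` the stopped process already equals `K_t`. -/
theorem integral_kernelProcess_mul_integral (hT : 0 < T) (hM : IsPriceMartingale ℱ P S M)
    (hS : SqIntegrable P S) {t : TimeSet T} (ht : (t : ℝ) < T) {ψ : TimeSet T → Ω → ℝ}
    (hψm : Adapted ℱ ψ) (hψ : SqIntegrable P ψ) :
    ∫ ω, kernelProcess M t ω * (∫ s, ψ s ω) ∂P = pairing P (stoppedKernel M t) ψ := by
  have hK := sqIntegrable_stoppedKernel hT hM hS ht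
  rw [hψ.integral_mul_integral (memLp_kernelProcess hT hM hS t), pairing,
    integral_prod _ (hK.integrable_mul hψ)]
  refine integral_congr_ae ?_
  filter_upwards [hψ.ae_slice_time] with s hs
  simp only [stoppedKernel]
  rcases le_total s t with h | h
  · rw [min_eq_left h]
    simpa only [mul_comm] using integral_mul_kernelProcess hT hM hS h ht (hψm s) hs
  · rw [min_eq_right h]

/-- Both sides equal an expectation of `K_t` times a time integral: that of the stopped process is
`M_t`, that of `S` is `X`, and `E[K_t M_t] = E[K_t X]`. -/
theorem pairing_stoppedKernel_self (hT : 0 < T) (hM : IsPriceMartingale ℱ P S M)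
    (hS : SqIntegrable P S) (hSm : Adapted ℱ S) {t : TimeSet T} (ht : (t : ℝ) < T) :
    pairing P (stoppedKernel M t) (stoppedKernel M t) = pairing P (stoppedKernel M t) S := by
  have hK := sqIntegrable_stoppedKernel hT hM hS ht
  rw [← integral_kernelProcess_mul_integral hT hM hS ht (adapted_stoppedKernel hT hM t) hK,
    ← integral_kernelProcess_mul_integral hT hM hS ht hSm hS,
    ← hM.integral_mul hS (adapted_kernelProcess hT hM t) (memLp_kernelProcess hT hM hS t)]
  refine integral_congr_ae ?_
  filter_upwards [hK.ae_slice_path] with ω hω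
  rw [integral_stoppedKernel hT hM ht (hω.integrable one_le_two)]

/-- By the preceding identity `‖K^t - S‖² = ‖S‖² - ‖K^t‖²`, which is nonnegative. -/
theorem pairing_stoppedKernel_le (hT : 0 < T) (hM : IsPriceMartingale ℱ P S M)
    (hS : SqIntegrable P S) (hSm : Adapted ℱ S) {t : TimeSet T} (ht : (t : ℝ) < T) :
    pairing P (stoppedKernel M t) (stoppedKernel M t) ≤ pairing P S S := by
  have h := (sqIntegrable_stoppedKernel hT hM hS ht).sub_sq hS
  have h0 := pairing_self_nonneg (P := P) (f := fun s ω => stoppedKernel M t s ω - S s ω)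
  rw [← pairing_stoppedKernel_self hT hM hS hSm ht] at h
  linarith

theorem exists_seq_tendsto_timeEnd (hT : 0 < T) :
    ∃ t : ℕ → TimeSet T, (∀ n, (t n : ℝ) < T) ∧ Tendsto t atTop (𝓝 (timeEnd hT)) := by
  have h : (𝓝[<] (timeEnd hT)).NeBot := nhdsLT_neBot_of_exists_lt ⟨time0 hT, hT⟩
  obtain ⟨t, ht⟩ := exists_seq_tendsto (𝓝[<] (timeEnd hT))
  obtain ⟨N, hN⟩ := eventually_atTop.1 (ht.eventually self_mem_nhdsWithin)
  exact ⟨fun n => t (n + N), fun n => hN _ (Nat.le_add_left _ _),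
    (tendsto_add_atTop_iff_nat N).2 (ht.mono_right nhdsWithin_le_nhds)⟩

theorem eventually_stoppedKernel_eq (hT : 0 < T) {t : ℕ → TimeSet T}
    (ht : Tendsto t atTop (𝓝 (timeEnd hT))) {s : TimeSet T} (hs : (s : ℝ) < T) :
    ∀ᶠ n in atTop, s < t n ∧ ∀ ω, stoppedKernel M (t n) s ω = kernelProcess M s ω := by
  have hs' : s < timeEnd hT := hs
  filter_upwards [ht.eventually (lt_mem_nhds hs')] with n hn
  exact ⟨hn, fun ω => by rw [stoppedKernel, min_eq_left hn.le]⟩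

/-- Fatou's lemma along `t → T`: at each time before `T` the stopped processes eventually agree with
`K`. -/
theorem sqIntegrable_kernelProcess (hT : 0 < T) (hM : IsPriceMartingale ℱ P S M)
    (hS : SqIntegrable P S) (hSm : Adapted ℱ S) : SqIntegrable P (kernelProcess M) ∧
      pairing P (kernelProcess M) (kernelProcess M) ≤ pairing P S S := by
  obtain ⟨t, ht, htT⟩ := exists_seq_tendsto_timeEnd hT
  have hKm := measurable_uncurry_of_isProgressive hT (isProgressive_kernelProcess hT hM)
  have hle : ∫⁻ p : TimeSet T × Ω, ENNReal.ofReal (kernelProcess M p.1 p.2 ^ 2) ∂(volume.prod P) ≤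
      ENNReal.ofReal (pairing P S S) := by
    have hlim : ∀ᵐ p : TimeSet T × Ω ∂(volume.prod P),
        ENNReal.ofReal (kernelProcess M p.1 p.2 ^ 2) = liminf
          (fun n => ENNReal.ofReal (stoppedKernel M (t n) p.1 p.2 ^ 2)) atTop := by
      have hlt : ∀ᵐ p : TimeSet T × Ω ∂(volume.prod P), (p.1 : ℝ) < T :=
        Measure.quasiMeasurePreserving_fst.ae ae_lt_timeSet
      filter_upwards [hlt] with p hp
      refine (Tendsto.liminf_eq (tendsto_const_nhds.congr' ?_)).symm
      filter_upwards [eventually_stoppedKernel_eq (M := M) hT htT hp] with n hn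
      rw [hn.2]
    rw [lintegral_congr_ae hlim]
    refine (lintegral_liminf_le fun n =>
      ((measurable_uncurry_stoppedKernel hT hM (t n)).pow_const 2).ennreal_ofReal).trans ?_
    refine liminf_le_of_le (by isBoundedDefault) fun c hc => ?_
    obtain ⟨n, hn⟩ := hc.exists
    refine hn.trans ?_
    rw [← ofReal_integral_eq_lintegral_ofReal (sqIntegrable_stoppedKernel hT hM hS (ht n)).integrable_sq
      (Eventually.of_forall fun _ => sq_nonneg _)]
    refine ENNReal.ofReal_le_ofReal ?_
    simpa only [pairing, sq] using pairing_stoppedKernel_le hT hM hS hSm (ht n)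
  have hint : Integrable (fun p : TimeSet T × Ω => kernelProcess M p.1 p.2 ^ 2) (volume.prod P) := by
    refine ⟨(hKm.pow_const 2).aestronglyMeasurable, ?_⟩
    rw [hasFiniteIntegral_iff_ofReal (Eventually.of_forall fun _ => sq_nonneg _)]
    exact hle.trans_lt ENNReal.ofReal_lt_top
  refine ⟨(memLp_two_iff_integrable_sq hKm.aestronglyMeasurable).2 hint, ?_⟩
  rw [← ofReal_integral_eq_lintegral_ofReal hint (Eventually.of_forall fun _ => sq_nonneg _),
    ENNReal.ofReal_le_ofReal_iff pairing_self_nonneg] at hle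
  simpa only [pairing, sq] using hle

/-- `kernelProcess` is orthogonal to the adapted processes with vanishing time integral. -/
theorem pairing_kernelProcess_eq_zero (hT : 0 < T) (hM : IsPriceMartingale ℱ P S M)
    (hS : SqIntegrable P S) (hSm : Adapted ℱ S) {ψ : TimeSet T → Ω → ℝ} (hψm : Adapted ℱ ψ)
    (hψ : SqIntegrable P ψ) (h0 : ∀ᵐ ω ∂P, ∫ s, ψ s ω = 0) :
    pairing P (kernelProcess M) ψ = 0 := by
  obtain ⟨t, ht, htT⟩ := exists_seq_tendsto_timeEnd hT
  obtain ⟨hK, hKle⟩ := sqIntegrable_kernelProcess hT hM hS hSm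
  -- A bound for `‖K - K^t‖² ≤ 2‖K‖² + 2‖K^t‖²`, uniform in `t`.
  set B := 4 * pairing P S S with hB
  have hB0 : 0 ≤ B := mul_nonneg (by norm_num) pairing_self_nonneg
  set R : ℕ → ℝ := fun n => ∫ p : TimeSet T × Ω, (Set.Ioi (t n) ×ˢ Set.univ).indicator
      (fun p => ψ p.1 p.2 * ψ p.1 p.2) p ∂(volume.prod P) with hR
  have hRt : Tendsto R atTop (𝓝 0) := tendsto_pairing_Ioi hT htT hψ
  -- Since `⟨K^t, ψ⟩ = 0`, only `K - K^t` matters, and it vanishes on `[0, t]`. Young's inequality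
  -- with weight `δ` isolates the tail of `‖ψ‖²`, which tends to zero for fixed `δ`; only then is
  -- `δ` made small.
  have key : ∀ δ : ℝ, 0 < δ → ∀ n, |pairing P (kernelProcess M) ψ| ≤ δ * B + 1 / δ * R n := by
    intro δ hδ n
    have hKn := sqIntegrable_stoppedKernel hT hM hS (ht n)
    have hz : pairing P (stoppedKernel M (t n)) ψ = 0 := by
      rw [← integral_kernelProcess_mul_integral hT hM hS (ht n) hψm hψ]
      refine integral_eq_zero_of_ae ?_
      filter_upwards [h0] with ω hω
      rw [hω, mul_zero]; rfl
    set D : TimeSet T → Ω → ℝ := fun s ω => kernelProcess M s ω - stoppedKernel M (t n) s ω with hD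
    have hDs : SqIntegrable P D := hK.sub hKn
    have hDle : pairing P D D ≤ B := by
      have h1 := hK.sub_sq_le hKn
      have h2 := pairing_stoppedKernel_le hT hM hS hSm (ht n)
      rw [hB]; linarith
    have e : pairing P (kernelProcess M) ψ = pairing P D ψ := by
      rw [← sub_zero (pairing P (kernelProcess M) ψ), ← hz, pairing, pairing,
        ← integral_sub (hK.integrable_mul hψ) (hKn.integrable_mul hψ)]
      simp only [pairing, hD, sub_mul]
    have hi2 : Integrable (fun p : TimeSet T × Ω => (Set.Ioi (t n) ×ˢ Set.univ).indicator
      (fun p => ψ p.1 p.2 * ψ p.1 p.2) p) (volume.prod P) :=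
      (hψ.integrable_mul hψ).indicator (measurableSet_Ioi.prod MeasurableSet.univ)
    have hi1 := hDs.integrable_mul hDs
    calc |pairing P (kernelProcess M) ψ| = |pairing P D ψ| := by rw [e]
      _ ≤ ∫ p : TimeSet T × Ω, |D p.1 p.2 * ψ p.1 p.2| ∂(volume.prod P) :=
        abs_integral_le_integral_abs
      _ ≤ ∫ p : TimeSet T × Ω, (δ * (D p.1 p.2 * D p.1 p.2) + 1 / δ *
          (Set.Ioi (t n) ×ˢ Set.univ).indicator (fun p => ψ p.1 p.2 * ψ p.1 p.2) p)
          ∂(volume.prod P) := by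
        refine integral_mono (hDs.integrable_mul hψ).abs ((hi1.const_mul δ).add
          (hi2.const_mul (1 / δ))) fun p => ?_
        beta_reduce
        by_cases hp : p ∈ Set.Ioi (t n) ×ˢ (Set.univ : Set Ω)
        · rw [Set.indicator_of_mem hp, abs_mul]
          have h1 : 1 / δ * (δ * δ) = δ := by field_simp
          have h2 := mul_nonneg (show (0:ℝ) ≤ 1 / δ by positivity)
            (mul_self_nonneg (δ * |D p.1 p.2| - |ψ p.1 p.2|))
          have h3 : 1 / δ * ((δ * |D p.1 p.2| - |ψ p.1 p.2|) * (δ * |D p.1 p.2| - |ψ p.1 p.2|)) =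
              δ * (|D p.1 p.2| * |D p.1 p.2|) + 1 / δ * (|ψ p.1 p.2| * |ψ p.1 p.2|) -
                2 * (|D p.1 p.2| * |ψ p.1 p.2|) := by
            field_simp; ring
          rw [h3, abs_mul_abs_self, abs_mul_abs_self] at h2
          have h4 := mul_nonneg (abs_nonneg (D p.1 p.2)) (abs_nonneg (ψ p.1 p.2))
          linarith
        · have hle : p.1 ≤ t n := not_lt.1 fun h => hp ⟨h, trivial⟩
          have : D p.1 p.2 = 0 := by
            simp only [hD, stoppedKernel, min_eq_left hle, sub_self]
          rw [Set.indicator_of_notMem hp, this]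
          simp
      _ = δ * pairing P D D + 1 / δ * R n := by
        rw [integral_add (hi1.const_mul δ) (hi2.const_mul (1 / δ)), integral_const_mul,
          integral_const_mul]
        rfl
      _ ≤ δ * B + 1 / δ * R n := by gcongr
  have key2 : ∀ δ : ℝ, 0 < δ → |pairing P (kernelProcess M) ψ| ≤ δ * B := by
    intro δ hδ
    have h := (hRt.const_mul (1 / δ)).const_add (δ * B)
    rw [mul_zero, add_zero] at h
    exact ge_of_tendsto' h (key δ hδ)
  by_contra hne
  have hpos := abs_pos.2 hne
  have h := key2 (|pairing P (kernelProcess M) ψ| / (2 * (B + 1))) (by positivity)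
  rw [div_mul_eq_mul_div, le_div_iff₀ (by positivity)] at h
  nlinarith

/-- `M_t` is the best `L²` approximation of `X` by `ℱ t`-measurable variables, hence at least as
good as `∫₀ᵗ S du`, whose error is the integral of `S` over `(t, T]`. -/
theorem integral_priceMartingale_sub_sq_le (hM : IsPriceMartingale ℱ P S M)
    (hS : SqIntegrable P S) (hSm : IsProgressive ℱ S) (t : TimeSet T) :
    ∫ ω, ((∫ u, S u ω) - M t ω) ^ 2 ∂P ≤ (T - t) * pairing P S S := by
  set A : Ω → ℝ := fun ω => ∫ u in Set.Iic t, S u ω with hA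
  have hAm : Measurable[ℱ t] A := measurable_setIntegral_of_isProgressive hSm t
  have hA2 : MemLp A 2 P := (hS.setIntegral _).1
  have hX := hS.integral
  have hMt := hM.memLp hS t
  have e : ∫ ω, ((∫ u, S u ω) - A ω) ^ 2 ∂P ≤ (T - t) * pairing P S S := by
    rw [← volume_Ioi_timeSet]
    refine le_of_eq_of_le (integral_congr_ae ?_) (hS.setIntegral (Set.Ioi t)).2
    filter_upwards [hS.ae_slice_path] with ω hω
    rw [integral_eq_add_Ioi t (hω.integrable one_le_two), hA]
    ring
  have h1 := integral_sub_sq hX hMt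
  have h2 := integral_sub_sq hX hA2
  have h3 := integral_sub_sq hMt hA2
  have h4 := hM.integral_mul hS (hM.adapted t) hMt
  have h5 := hM.integral_mul hS hAm hA2
  have h6 : 0 ≤ ∫ ω, (M t ω - A ω) ^ 2 ∂P := integral_nonneg fun _ => sq_nonneg _
  simp only [mul_comm (M t _)] at h3 h4
  simp only [mul_comm (A _) (∫ _, _)] at h5
  rw [h5] at h3
  simp only [← sq] at h4
  linarith

/-- `∫₀ᵀ K_t dt = ∫₀ᵀ S_t dt` for `K = kernelProcess M`. -/
theorem integral_kernelProcess_ae_eq (hT : 0 < T) (hM : IsPriceMartingale ℱ P S M)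
    (hS : SqIntegrable P S) (hSm : IsProgressive ℱ S) :
    ∀ᵐ ω ∂P, ∫ s, kernelProcess M s ω = ∫ s, S s ω := by
  obtain ⟨t, ht, htT⟩ := exists_seq_tendsto_timeEnd hT
  obtain ⟨hK, hKle⟩ := sqIntegrable_kernelProcess hT hM hS hSm.adapted
  set X : Ω → ℝ := fun ω => ∫ u, S u ω with hXdef
  set Y : Ω → ℝ := fun ω => ∫ u, kernelProcess M u ω with hYdef
  have hX : MemLp X 2 P := hS.integral
  have hY : MemLp Y 2 P := hK.integral
  -- Pass through `M_t`: twice the error `(T-t)‖S‖²` of `X - M_t` plus twice the error `4(T-t)‖S‖²`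
  -- of `M_t - Y` gives the constant `10`.
  have key : ∀ n, ∫ ω, (X ω - Y ω) ^ 2 ∂P ≤ (T - t n) * (10 * pairing P S S) := by
    intro n
    have hKn := sqIntegrable_stoppedKernel hT hM hS (ht n)
    set D : TimeSet T → Ω → ℝ := fun s ω => stoppedKernel M (t n) s ω - kernelProcess M s ω with hD
    have hDs : SqIntegrable P D := hKn.sub hK
    have h1 := integral_priceMartingale_sub_sq_le hM hS hSm (t n)
    have h2 := (hDs.setIntegral (Set.Ioi (t n))).2
    have h3 := hKn.sub_sq_le hK
    have h4 := pairing_stoppedKernel_le hT hM hS hSm.adapted (ht n)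
    rw [volume_Ioi_timeSet] at h2
    have hMt := hM.memLp hS (t n)
    -- `D` vanishes up to `t n`, and the stopped process has total integral `M (t n)`.
    have hDi : ∀ᵐ ω ∂P, ∫ u in Set.Ioi (t n), D u ω = M (t n) ω - Y ω := by
      filter_upwards [hDs.ae_slice_path, hKn.ae_slice_path, hK.ae_slice_path] with ω a1 a2 a3
      have b1 := integral_eq_add_Ioi (t n) (a1.integrable one_le_two)
      have b2 : ∫ u in Set.Iic (t n), D u ω = 0 := by
        refine setIntegral_eq_zero_of_forall_eq_zero fun u hu => ?_
        simp only [hD, stoppedKernel, min_eq_left (show u ≤ t n from hu), sub_self]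
      have b3 : ∫ u, D u ω = M (t n) ω - Y ω := by
        simp only [hD]
        rw [integral_sub (a2.integrable one_le_two) (a3.integrable one_le_two),
          integral_stoppedKernel hT hM (ht n) (a2.integrable one_le_two)]
      linarith
    have h5 : ∫ ω, (M (t n) ω - Y ω) ^ 2 ∂P ≤ (T - t n) * pairing P D D := by
      refine le_of_eq_of_le (integral_congr_ae ?_) h2
      filter_upwards [hDi] with ω hω
      rw [hω]
    have h6 : ∫ ω, (X ω - Y ω) ^ 2 ∂P ≤
        2 * ∫ ω, (X ω - M (t n) ω) ^ 2 ∂P + 2 * ∫ ω, (M (t n) ω - Y ω) ^ 2 ∂P := by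
      have i1 := ((hX.sub hMt).integrable_sq).const_mul 2
      have i2 := ((hMt.sub hY).integrable_sq).const_mul 2
      have h := integral_mono (hX.sub hY).integrable_sq (i1.add i2) fun ω => by
        simp only [Pi.sub_apply, Pi.add_apply]
        nlinarith [sq_nonneg ((X ω - M (t n) ω) - (M (t n) ω - Y ω))]
      have h' := integral_add i1 i2
      rw [integral_const_mul, integral_const_mul] at h'
      exact h.trans_eq h'
    have hpos : 0 ≤ T - (t n : ℝ) := by linarith [ht n]
    have h7 : (T - t n) * pairing P D D ≤ (T - t n) * (4 * pairing P S S) :=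
      mul_le_mul_of_nonneg_left (by linarith) hpos
    linarith
  have hlim : Tendsto (fun n => (T - (t n : ℝ)) * (10 * pairing P S S)) atTop (𝓝 0) := by
    have h1 : Tendsto (fun n => (t n : ℝ)) atTop (𝓝 T) :=
      (continuous_subtype_val.tendsto _).comp htT
    simpa using (h1.const_sub T).mul_const (10 * pairing P S S)
  have hle : ∫ ω, (X ω - Y ω) ^ 2 ∂P ≤ 0 := ge_of_tendsto' hlim key
  have h0 : ∫ ω, (X ω - Y ω) ^ 2 ∂P = 0 := le_antisymm hle (integral_nonneg fun _ => sq_nonneg _)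
  have hi : Integrable (fun ω => (X ω - Y ω) ^ 2) P := (hX.sub hY).integrable_sq
  rw [integral_eq_zero_iff_of_nonneg (fun _ => sq_nonneg _) hi] at h0
  filter_upwards [h0] with ω hω
  have := pow_eq_zero_iff (two_ne_zero) |>.1 (show (X ω - Y ω) ^ 2 = 0 from hω)
  linarith

end KernelProcess

/-! ### Extended expectations. -/

section Expectation

variable {Ω : Type*} {mΩ : MeasurableSpace Ω} {P : Measure Ω} {X : Ω → ℝ}

theorem extExpectation_of_integrable (hX : Integrable X P) :
    extExpectation P X = ((∫ ω, X ω ∂P : ℝ) : EReal) := by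
  have h1 : ∫⁻ ω, ENNReal.ofReal (X ω) ∂P ≠ ⊤ := hX.lintegral_lt_top.ne
  have h2 : ∫⁻ ω, ENNReal.ofReal (-X ω) ∂P ≠ ⊤ := hX.neg.lintegral_lt_top.ne
  rw [extExpectation, integral_eq_lintegral_pos_part_sub_lintegral_neg_part hX, EReal.coe_sub,
    ← EReal.coe_ennreal_toReal h1, ← EReal.coe_ennreal_toReal h2]

theorem extExpectation_eq_bot (h : ∫⁻ ω, ENNReal.ofReal (-X ω) ∂P = ⊤) :
    extExpectation P X = ⊥ := by
  rw [extExpectation, h, EReal.coe_ennreal_top, EReal.sub_top]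

theorem integrable_of_lintegral_ofReal (hX : AEMeasurable X P)
    (h1 : ∫⁻ ω, ENNReal.ofReal (X ω) ∂P < ⊤) (h2 : ∫⁻ ω, ENNReal.ofReal (-X ω) ∂P < ⊤) :
    Integrable X P := by
  refine ⟨hX.aestronglyMeasurable, ?_⟩
  rw [hasFiniteIntegral_iff_norm]
  calc ∫⁻ ω, ENNReal.ofReal ‖X ω‖ ∂P
      ≤ ∫⁻ ω, (ENNReal.ofReal (X ω) + ENNReal.ofReal (-X ω)) ∂P := by
        refine lintegral_mono fun ω => ?_
        rcases le_total 0 (X ω) with h | h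
        · rw [Real.norm_of_nonneg h]; exact le_self_add
        · rw [Real.norm_of_nonpos h]; exact le_add_self
    _ = ∫⁻ ω, ENNReal.ofReal (X ω) ∂P + ∫⁻ ω, ENNReal.ofReal (-X ω) ∂P :=
        lintegral_add_left' hX.ennreal_ofReal _
    _ < ⊤ := ENNReal.add_lt_top.2 ⟨h1, h2⟩

end Expectation

/-! ### Expected profit: bounds and completion of the square. -/

section Profit

variable {Ω : Type*} {mΩ : MeasurableSpace Ω} {P : Measure Ω} {T : ℝ}
  {ℱ : Filtration (TimeSet T) mΩ} {S M φ : TimeSet T → Ω → ℝ} {Λ Φ₀ : ℝ}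

theorem IsAdmissible.ae_memLp (hT : 0 < T) (hφ : IsAdmissible ℱ P Φ₀ φ) :
    ∀ᵐ ω ∂P, MemLp (fun t => φ t ω) 2 (volume : Measure (TimeSet T)) := by
  filter_upwards [hφ.sq_integrable] with ω hω
  have hm : Measurable fun t => φ t ω :=
    (measurable_uncurry_of_isProgressive hT hφ.progressive).comp measurable_prodMk_right
  refine (memLp_two_iff_integrable_sq hm.aestronglyMeasurable).2
    ⟨(hm.pow_const 2).aestronglyMeasurable, ?_⟩
  rwa [hasFiniteIntegral_iff_ofReal (Eventually.of_forall fun _ => sq_nonneg _)]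

variable [IsProbabilityMeasure P]

theorem sqIntegrable_of_lintegral (hT : 0 < T) (hSm : IsProgressive ℱ S)
    (hS : ∫⁻ ω, ∫⁻ t, ENNReal.ofReal (S t ω ^ 2) ∂volume ∂P < ⊤) : SqIntegrable P S := by
  have hm := measurable_uncurry_of_isProgressive hT hSm
  refine (memLp_two_iff_integrable_sq hm.aestronglyMeasurable).2
    ⟨(hm.pow_const 2).aestronglyMeasurable, ?_⟩
  rw [hasFiniteIntegral_iff_ofReal (Eventually.of_forall fun _ => sq_nonneg _),
    lintegral_prod_symm' _ (hm.pow_const 2).ennreal_ofReal]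
  exact hS

theorem measurable_profit (hT : 0 < T) (hSm : IsProgressive ℱ S) (hφ : IsProgressive ℱ φ) :
    Measurable (profit hT S Λ Φ₀ φ) := by
  have h1 := measurable_uncurry_of_isProgressive hT hSm
  have h2 := measurable_uncurry_of_isProgressive hT hφ
  have h3 : Measurable fun ω => ∫ t, φ t ω * S t ω :=
    (h2.mul h1).stronglyMeasurable.integral_prod_left'.measurable
  have h4 : Measurable fun ω => ∫ t, φ t ω ^ 2 :=
    (h2.pow_const 2).stronglyMeasurable.integral_prod_left'.measurable
  have h5 : Measurable (S (time0 hT)) := hSm.adapted.measurable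
  exact ((h5.const_mul _).sub h3).sub (h4.const_mul _)

/-- Young's inequality `-φS ≤ S²/Λ + Λφ²/4` absorbs only half of the quadratic cost. The other half
lets integrability of the profit control `E ∫ φ²`; dropping it bounds the positive part of the
profit. -/
theorem profit_le (hT : 0 < T) (hΛ : 0 < Λ) {ω : Ω}
    (hS : MemLp (fun t => S t ω) 2 (volume : Measure (TimeSet T)))
    (hφ : MemLp (fun t => φ t ω) 2 (volume : Measure (TimeSet T))) :
    profit hT S Λ Φ₀ φ ω ≤ -(Φ₀ * S (time0 hT) ω) + 1 / Λ * (∫ t, S t ω ^ 2) -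
      Λ / 4 * ∫ t, φ t ω ^ 2 := by
  have i1 : Integrable (fun t => φ t ω * S t ω) := MemLp.integrable_mul hφ hS
  have i2 := hS.integrable_sq.const_mul (1 / Λ)
  have i3 := hφ.integrable_sq.const_mul (Λ / 4)
  have h := integral_mono i1.neg (i2.add i3) fun t => by
    change -(φ t ω * S t ω) ≤ 1 / Λ * S t ω ^ 2 + Λ / 4 * φ t ω ^ 2
    have e : 1 / Λ * S t ω ^ 2 + Λ / 4 * φ t ω ^ 2 + φ t ω * S t ω =
        1 / Λ * (S t ω + Λ / 2 * φ t ω) ^ 2 := by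
      field_simp; ring
    have : 0 ≤ 1 / Λ * (S t ω + Λ / 2 * φ t ω) ^ 2 := by positivity
    linarith
  have h2 := integral_add i2 i3
  rw [integral_const_mul, integral_const_mul] at h2
  have h3 : ∫ t, (-fun t => φ t ω * S t ω) t = - ∫ t, φ t ω * S t ω := integral_neg _
  rw [h3] at h
  have h4 := h.trans_eq h2
  rw [profit]
  linarith

theorem integrable_profitBound (hT : 0 < T) (hS : SqIntegrable P S)
    (hS0 : Integrable (fun ω => Φ₀ * S (time0 hT) ω) P) :
    Integrable (fun ω => -(Φ₀ * S (time0 hT) ω) + 1 / Λ * ∫ t, S t ω ^ 2) P :=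
  hS0.neg.add (hS.integrable_sq.integral_prod_right.const_mul _)

theorem lintegral_profit_lt_top (hT : 0 < T) (hΛ : 0 < Λ) (hS : SqIntegrable P S)
    (hS0 : Integrable (fun ω => Φ₀ * S (time0 hT) ω) P) (hφ : IsAdmissible ℱ P Φ₀ φ) :
    ∫⁻ ω, ENNReal.ofReal (profit hT S Λ Φ₀ φ ω) ∂P < ⊤ := by
  refine lt_of_le_of_lt ?_ (integrable_profitBound (Λ := Λ) hT hS hS0).lintegral_lt_top
  refine lintegral_mono_ae ?_
  filter_upwards [hS.ae_slice_path, hφ.ae_memLp hT] with ω h1 h2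
  refine ENNReal.ofReal_le_ofReal ((profit_le hT hΛ h1 h2).trans ?_)
  have : 0 ≤ Λ / 4 * ∫ t, φ t ω ^ 2 :=
    mul_nonneg (by positivity) (integral_nonneg fun _ => sq_nonneg _)
  linarith

/-- The positive part of the profit always has finite expectation. If the negative part does too,
the profit is integrable and `profit_le` bounds `E ∫ φ²`. -/
theorem IsAdmissible.sqIntegrable_or_eq_bot (hT : 0 < T) (hΛ : 0 < Λ) (hSm : IsProgressive ℱ S)
    (hS : SqIntegrable P S) (hS0 : Integrable (fun ω => Φ₀ * S (time0 hT) ω) P)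
    (hφ : IsAdmissible ℱ P Φ₀ φ) :
    SqIntegrable P φ ∨ extExpectation P (profit hT S Λ Φ₀ φ) = ⊥ := by
  have h1 := lintegral_profit_lt_top hT hΛ hS hS0 hφ
  rcases eq_or_ne (∫⁻ ω, ENNReal.ofReal (-profit hT S Λ Φ₀ φ ω) ∂P) ⊤ with h2 | h2
  · exact Or.inr (extExpectation_eq_bot h2)
  left
  have hV := integrable_of_lintegral_ofReal (measurable_profit hT hSm hφ.progressive).aemeasurable
    h1 h2.lt_top
  have hm := measurable_uncurry_of_isProgressive hT hφ.progressive
  refine (memLp_two_iff_integrable_sq hm.aestronglyMeasurable).2 ?_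
  rw [integrable_prod_iff' (hm.pow_const 2).aestronglyMeasurable]
  constructor
  · filter_upwards [hφ.ae_memLp hT] with ω hω using hω.integrable_sq
  · simp only [norm_pow, Real.norm_eq_abs, sq_abs]
    refine (((integrable_profitBound (Λ := Λ) hT hS hS0).sub hV).const_mul (4 / Λ)).mono'
      (hm.pow_const 2).stronglyMeasurable.integral_prod_left'.aestronglyMeasurable ?_
    filter_upwards [hS.ae_slice_path, hφ.ae_memLp hT] with ω a1 a2
    rw [Real.norm_of_nonneg (integral_nonneg fun _ => sq_nonneg _)]
    have h := profit_le (Φ₀ := Φ₀) hT hΛ a1 a2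
    simp only [Pi.sub_apply]
    rw [div_mul_eq_mul_div, le_div_iff₀ hΛ]
    linarith

theorem SqIntegrable.integrable_profit (hT : 0 < T) (hS : SqIntegrable P S)
    (hS0 : Integrable (fun ω => Φ₀ * S (time0 hT) ω) P) (hφ : SqIntegrable P φ) :
    Integrable (profit hT S Λ Φ₀ φ) P ∧ ∫ ω, profit hT S Λ Φ₀ φ ω ∂P =
      -(∫ ω, Φ₀ * S (time0 hT) ω ∂P) - pairing P φ S - Λ / 2 * pairing P φ φ := by
  have i1 : Integrable (fun ω => -Φ₀ * S (time0 hT) ω) P := by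
    exact hS0.neg.congr (Eventually.of_forall fun ω => (neg_mul _ _).symm)
  have i2 : Integrable (fun ω => ∫ t, φ t ω * S t ω) P :=
    (hφ.integrable_mul hS).integral_prod_right
  have i3 : Integrable (fun ω => Λ / 2 * ∫ t, φ t ω ^ 2) P :=
    hφ.integrable_sq.integral_prod_right.const_mul _
  have i12 : Integrable (fun ω => -Φ₀ * S (time0 hT) ω - ∫ t, φ t ω * S t ω) P := i1.sub i2
  refine ⟨i12.sub i3, ?_⟩
  have e2 : ∫ ω, (∫ t, φ t ω * S t ω) ∂P = pairing P φ S :=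
    (integral_prod_symm _ (hφ.integrable_mul hS)).symm
  have e3 : ∫ ω, (∫ t, φ t ω ^ 2) ∂P = pairing P φ φ := by
    simp only [pairing, ← sq]
    exact (integral_prod_symm _ hφ.integrable_sq).symm
  simp only [profit]
  rw [integral_sub i12 i3, integral_sub i1 i2, integral_const_mul (Λ / 2), e2, e3]
  simp only [neg_mul, integral_neg]

/-- The candidate rate, up to null sets, in terms of `kernelProcess`. -/
noncomputable def kernelRate (S M : TimeSet T → Ω → ℝ) (Λ Φ₀ : ℝ) (t : TimeSet T) (ω : Ω) : ℝ :=
  -(Φ₀ / T) + 1 / Λ * (kernelProcess M t ω - S t ω)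

/-- Completing the square in the expected profit. -/
theorem integral_profit_eq (hT : 0 < T) (hΛ : 0 < Λ) (hM : IsPriceMartingale ℱ P S M)
    (hSm : IsProgressive ℱ S) (hS : SqIntegrable P S)
    (hS0 : Integrable (fun ω => Φ₀ * S (time0 hT) ω) P) (hφm : IsProgressive ℱ φ)
    (hφ : SqIntegrable P φ) (hφ0 : ∀ᵐ ω ∂P, Φ₀ + ∫ t, φ t ω = 0) :
    ∫ ω, profit hT S Λ Φ₀ φ ω ∂P =
      -(Φ₀ ^ 2 * Λ) / (2 * T) + (Φ₀ / T * (∫ ω, (∫ t, S t ω) ∂P) - ∫ ω, Φ₀ * S (time0 hT) ω ∂P) +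
        1 / (2 * Λ) * pairing P (fun t ω => kernelProcess M t ω - S t ω)
          (fun t ω => kernelProcess M t ω - S t ω) -
        Λ / 2 * pairing P (fun t ω => φ t ω - kernelRate S M Λ Φ₀ t ω)
          (fun t ω => φ t ω - kernelRate S M Λ Φ₀ t ω) := by
  obtain ⟨hK, -⟩ := sqIntegrable_kernelProcess hT hM hS hSm.adapted
  have hKS := integral_kernelProcess_ae_eq hT hM hS hSm
  set K := kernelProcess M with hKdef
  set c := Φ₀ / T with hc
  set D : TimeSet T → Ω → ℝ := fun t ω => K t ω - S t ω with hD
  have hDs : SqIntegrable P D := hK.sub hS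
  have hcs : SqIntegrable P fun (_ : TimeSet T) (_ : Ω) => c := memLp_const c
  have hψ : SqIntegrable P fun t ω => φ t ω + c := hφ.add hcs
  have hR : SqIntegrable P (kernelRate S M Λ Φ₀) := by
    have h := hcs.neg.add (MemLp.const_mul hDs (1 / Λ))
    exact h
  have hE : SqIntegrable P fun t ω => φ t ω - kernelRate S M Λ Φ₀ t ω := hφ.sub hR
  have hvol : (volume : Measure (TimeSet T)).real Set.univ = T := volume_real_univ_timeSet hT
  have horth : pairing P K (fun t ω => φ t ω + c) = 0 := by
    refine pairing_kernelProcess_eq_zero hT hM hS hSm.adapted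
      (fun t => (hφm.adapted t).add_const c) hψ ?_
    filter_upwards [hφ0, hφ.ae_slice_path] with ω h1 h2
    rw [integral_add (h2.integrable one_le_two) (integrable_const _), integral_const, hvol,
      smul_eq_mul, hc, mul_div_cancel₀ _ hT.ne']
    linarith
  have hμ : ∀ {f : TimeSet T → Ω → ℝ}, SqIntegrable P f →
      ∫ p : TimeSet T × Ω, f p.1 p.2 ∂(volume.prod P) = ∫ ω, (∫ t, f t ω) ∂P := fun hf =>
    integral_prod_symm _ (hf.integrable one_le_two)
  have e1 : ∫ p : TimeSet T × Ω, φ p.1 p.2 ∂(volume.prod P) = -Φ₀ := by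
    rw [hμ hφ]
    have : ∀ᵐ ω ∂P, ∫ t, φ t ω = -Φ₀ := hφ0.mono fun ω h => by linarith
    rw [integral_congr_ae this]
    simp
  have e2 : ∫ p : TimeSet T × Ω, K p.1 p.2 ∂(volume.prod P) = ∫ ω, (∫ t, S t ω) ∂P := by
    rw [hμ hK, integral_congr_ae hKS]
  have e3 : ∫ p : TimeSet T × Ω, S p.1 p.2 ∂(volume.prod P) = ∫ ω, (∫ t, S t ω) ∂P := hμ hS
  have e4 : ∫ _ : TimeSet T × Ω, (1 : ℝ) ∂(volume.prod P) = T := by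
    rw [integral_prod_symm _ (integrable_const _)]
    simp [hvol]
  have iφ := hφ.integrable one_le_two
  have iK := hK.integrable one_le_two
  have iS := hS.integrable one_le_two
  have iφS := hφ.integrable_mul hS
  have iφφ := hφ.integrable_mul hφ
  have iEE := hE.integrable_mul hE
  have iDD := hDs.integrable_mul hDs
  have iKψ := hK.integrable_mul hψ
  have i1 : Integrable (fun _ : TimeSet T × Ω => (1 : ℝ)) (volume.prod P) := integrable_const _
  -- With `c = Φ₀ / T`, this expands `Λ/2 * (φ + c - D/Λ)²`; its cross term `-(φ + c) * (K - S)` is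
  -- what `K * (φ + c)` turns into `S * (φ + c)`.
  have hpt : ∀ p : TimeSet T × Ω,
      φ p.1 p.2 * S p.1 p.2 + Λ / 2 * (φ p.1 p.2 * φ p.1 p.2) +
        (c * S p.1 p.2 + (Λ * c * φ p.1 p.2 + Λ / 2 * c ^ 2 * 1)) +
        1 / (2 * Λ) * (D p.1 p.2 * D p.1 p.2) =
      K p.1 p.2 * (φ p.1 p.2 + c) + Λ / 2 * ((φ p.1 p.2 - kernelRate S M Λ Φ₀ p.1 p.2) *
        (φ p.1 p.2 - kernelRate S M Λ Φ₀ p.1 p.2)) := by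
    intro p
    simp only [kernelRate, ← hKdef, ← hc, hD]
    field_simp
    ring
  have hint := integral_congr_ae (μ := volume.prod P) (Eventually.of_forall hpt)
  have j1 : Integrable (fun p : TimeSet T × Ω => Λ * c * φ p.1 p.2 + Λ / 2 * c ^ 2 * 1)
      (volume.prod P) := (iφ.const_mul _).add (i1.const_mul _)
  have j2 : Integrable (fun p : TimeSet T × Ω => c * S p.1 p.2 +
      (Λ * c * φ p.1 p.2 + Λ / 2 * c ^ 2 * 1)) (volume.prod P) := (iS.const_mul _).add j1
  have j3 : Integrable (fun p : TimeSet T × Ω => φ p.1 p.2 * S p.1 p.2 +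
      Λ / 2 * (φ p.1 p.2 * φ p.1 p.2)) (volume.prod P) := iφS.add (iφφ.const_mul _)
  have j4 : Integrable (fun p : TimeSet T × Ω => φ p.1 p.2 * S p.1 p.2 +
      Λ / 2 * (φ p.1 p.2 * φ p.1 p.2) + (c * S p.1 p.2 +
      (Λ * c * φ p.1 p.2 + Λ / 2 * c ^ 2 * 1))) (volume.prod P) := j3.add j2
  rw [integral_add j4 (iDD.const_mul _), integral_add j3 j2, integral_add iφS (iφφ.const_mul _),
    integral_add (iS.const_mul _) j1, integral_add (iφ.const_mul _) (i1.const_mul _),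
    integral_add iKψ (iEE.const_mul _), integral_const_mul, integral_const_mul, integral_const_mul,
    integral_const_mul, integral_const_mul, integral_const_mul, e1, e3, e4] at hint
  rw [(hS.integrable_profit hT hS0 hφ).2]
  simp only [pairing] at horth ⊢
  rw [horth] at hint
  have hcT : Λ * c * -Φ₀ + Λ / 2 * c ^ 2 * T = -(Φ₀ ^ 2 * Λ) / (2 * T) := by
    rw [hc]; field_simp; ring
  linarith

end Profit

/-! ### The candidate rate and its admissibility. -/

section Candidate

variable {Ω : Type*} {mΩ : MeasurableSpace Ω} {P : Measure Ω} {T : ℝ} {hT : 0 < T}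
  {ℱ : Filtration (TimeSet T) mΩ} {S M N : TimeSet T → Ω → ℝ} {Λ Φ₀ : ℝ}

theorem candidateRate_of_lt {t : TimeSet T} (ht : (t : ℝ) < T) :
    candidateRate hT S M N Λ Φ₀ t = fun ω =>
      -Φ₀ / T + M (time0 hT) ω / (T * Λ) + 1 / Λ * (N t ω - S t ω) :=
  funext fun _ => if_pos ht

theorem isProgressive_candidateRate (hS : Adapted ℱ S) (hSr : ∀ ω t, IsRCLLAt (fun s => S s ω) t)
    (hM : IsPriceMartingale ℱ P S M) (hN : IsStochasticIntegral hT ℱ P kernel M N) :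
    IsProgressive ℱ (candidateRate hT S M N Λ Φ₀) := by
  refine isProgressive_of_rightContinuous (fun t => ?_) fun ω t ht => ?_
  · by_cases ht : (t : ℝ) < T
    · rw [candidateRate_of_lt ht]
      exact (((hM.adapted.measurable_le (time0_le hT t)).div_const _).const_add _).add
        (((hN.adapted t ht).sub (hS t)).const_mul _)
    · rw [show candidateRate hT S M N Λ Φ₀ t = fun _ => (0 : ℝ) from funext fun _ => if_neg ht]
      exact measurable_const
  · have h : ContinuousWithinAt (fun s => -Φ₀ / T + M (time0 hT) ω / (T * Λ) +
        1 / Λ * (N s ω - S s ω)) (Set.Ici t) t :=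
      continuousWithinAt_const.add
        (continuousWithinAt_const.mul ((hN.rcll ω t ht).1.sub (hSr ω t).1))
    refine h.congr_of_eventuallyEq ?_ (congrFun (candidateRate_of_lt ht) ω)
    have : ∀ᶠ s : TimeSet T in 𝓝 t, s < timeEnd hT := gt_mem_nhds ht
    filter_upwards [nhdsWithin_le_nhds this] with s hs
    exact congrFun (candidateRate_of_lt hs) ω

/-- Joint measurability is what allows "for almost every `t`, almost surely" to be exchanged for
statements about `dt ⊗ P` or about almost every path. -/
theorem measurableSet_candidateRate_eq (hS : Adapted ℱ S)
    (hSr : ∀ ω t, IsRCLLAt (fun s => S s ω) t) (hM : IsPriceMartingale ℱ P S M)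
    (hN : IsStochasticIntegral hT ℱ P kernel M N) :
    MeasurableSet {p : TimeSet T × Ω |
      candidateRate hT S M N Λ Φ₀ p.1 p.2 = kernelRate S M Λ Φ₀ p.1 p.2} := by
  have hSm : IsProgressive ℱ S := isProgressive_of_rightContinuous hS fun ω t _ => (hSr ω t).1
  refine measurableSet_eq_fun
    (measurable_uncurry_of_isProgressive hT (isProgressive_candidateRate hS hSr hM hN)) ?_
  exact (((measurable_uncurry_of_isProgressive hT (isProgressive_kernelProcess hT hM)).sub
    (measurable_uncurry_of_isProgressive hT hSm)).const_mul _).const_add _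

variable [IsProbabilityMeasure P]

theorem ae_ae_candidateRate_eq (hΛ : 0 < Λ) (hM : IsPriceMartingale ℱ P S M)
    (hN : IsStochasticIntegral hT ℱ P kernel M N) : ∀ᵐ t : TimeSet T, ∀ᵐ ω ∂P,
      candidateRate hT S M N Λ Φ₀ t ω = kernelRate S M Λ Φ₀ t ω := by
  filter_upwards [ae_lt_timeSet] with t ht
  filter_upwards [hN.ae_eq_kernelPath hM ht] with ω hω
  rw [candidateRate_of_lt ht, kernelRate, kernelProcess_of_lt ht]
  beta_reduce
  rw [hω]
  field_simp
  ring

theorem ae_candidateRate_eq (hΛ : 0 < Λ) (hS : Adapted ℱ S)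
    (hSr : ∀ ω t, IsRCLLAt (fun s => S s ω) t) (hM : IsPriceMartingale ℱ P S M)
    (hN : IsStochasticIntegral hT ℱ P kernel M N) :
    ∀ᵐ p : TimeSet T × Ω ∂((volume : Measure (TimeSet T)).prod P),
      candidateRate hT S M N Λ Φ₀ p.1 p.2 = kernelRate S M Λ Φ₀ p.1 p.2 :=
  (Measure.ae_prod_iff_ae_ae (measurableSet_candidateRate_eq hS hSr hM hN)).2
    (ae_ae_candidateRate_eq hΛ hM hN)

theorem ae_path_candidateRate_eq (hΛ : 0 < Λ) (hS : Adapted ℱ S)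
    (hSr : ∀ ω t, IsRCLLAt (fun s => S s ω) t) (hM : IsPriceMartingale ℱ P S M)
    (hN : IsStochasticIntegral hT ℱ P kernel M N) : ∀ᵐ ω ∂P, ∀ᵐ t : TimeSet T,
      candidateRate hT S M N Λ Φ₀ t ω = kernelRate S M Λ Φ₀ t ω :=
  (Measure.ae_ae_comm (measurableSet_candidateRate_eq hS hSr hM hN)).1
    (ae_ae_candidateRate_eq hΛ hM hN)

theorem sqIntegrable_kernelRate (hT : 0 < T) (hM : IsPriceMartingale ℱ P S M)
    (hSm : IsProgressive ℱ S) (hS : SqIntegrable P S) :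
    SqIntegrable P (kernelRate S M Λ Φ₀) := by
  have hK := (sqIntegrable_kernelProcess hT hM hS hSm.adapted).1
  exact (memLp_const (-(Φ₀ / T))).add (MemLp.const_mul (MemLp.sub hK hS) (1 / Λ))

/-- The liquidation constraint holds because `K` and `S` have the same time integral. -/
theorem integral_kernelRate (hT : 0 < T) (hM : IsPriceMartingale ℱ P S M)
    (hSm : IsProgressive ℱ S) (hS : SqIntegrable P S) :
    ∀ᵐ ω ∂P, ∫ t, kernelRate S M Λ Φ₀ t ω = -Φ₀ := by
  have hK := (sqIntegrable_kernelProcess hT hM hS hSm.adapted).1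
  filter_upwards [integral_kernelProcess_ae_eq hT hM hS hSm, hK.ae_slice_path, hS.ae_slice_path]
    with ω h1 h2 h3
  have i2 := h2.integrable one_le_two
  have i3 := h3.integrable one_le_two
  have i23 : Integrable fun t => 1 / Λ * (kernelProcess M t ω - S t ω) := (i2.sub i3).const_mul _
  simp only [kernelRate]
  rw [integral_add (integrable_const _) i23, integral_const_mul,
    integral_sub i2 i3, h1, sub_self, mul_zero, add_zero, integral_const,
    volume_real_univ_timeSet hT, smul_eq_mul, mul_neg, mul_div_cancel₀ _ hT.ne']

theorem isAdmissible_candidateRate (hΛ : 0 < Λ) (hS : Adapted ℱ S)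
    (hSr : ∀ ω t, IsRCLLAt (fun s => S s ω) t) (hS2 : SqIntegrable P S)
    (hM : IsPriceMartingale ℱ P S M) (hN : IsStochasticIntegral hT ℱ P kernel M N) :
    IsAdmissible ℱ P Φ₀ (candidateRate hT S M N Λ Φ₀) := by
  have hSm : IsProgressive ℱ S := isProgressive_of_rightContinuous hS fun ω t _ => (hSr ω t).1
  have hae := ae_path_candidateRate_eq (Φ₀ := Φ₀) hΛ hS hSr hM hN
  refine ⟨isProgressive_candidateRate hS hSr hM hN, ?_, ?_⟩
  · filter_upwards [hae, (sqIntegrable_kernelRate (Λ := Λ) (Φ₀ := Φ₀) hT hM hSm hS2).ae_slice_path]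
      with ω h1 h2
    rw [lintegral_congr_ae (h1.mono fun t ht => by rw [ht])]
    exact h2.integrable_sq.lintegral_lt_top
  · filter_upwards [hae, integral_kernelRate (Λ := Λ) (Φ₀ := Φ₀) hT hM hSm hS2] with ω h1 h2
    rw [integral_congr_ae h1, h2, add_neg_cancel]

end Candidate

end Liquidation

/-! ### Optimality, uniqueness and the optimal value. -/

theorem theorem2p1 {Ω : Type*} {mΩ : MeasurableSpace Ω} (P : Measure Ω) [IsProbabilityMeasure P]
    {T : ℝ} (hT : 0 < T) (ℱ : Filtration (TimeSet T) mΩ) (hℱ : UsualAssumptions hT ℱ P)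
    (S : TimeSet T → Ω → ℝ) (hS : Adapted ℱ S) (hS_rcll : ∀ ω t, IsRCLLAt (fun s => S s ω) t)
    (hS_sq : ∫⁻ ω, ∫⁻ t, ENNReal.ofReal (S t ω ^ 2) ∂volume ∂P < ⊤)
    (Λ : ℝ) (hΛ : 0 < Λ) (Φ₀ : ℝ)
    (hS0 : Integrable (fun ω => Φ₀ * S (time0 hT) ω) P) :
    -- the martingale and the stochastic integral exist
    (∃ M N : TimeSet T → Ω → ℝ,
      IsPriceMartingale ℱ P S M ∧ IsStochasticIntegral hT ℱ P kernel M N) ∧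
    -- the expected profit of every admissible rate is well defined, with values in `[-∞, ∞)`
    (∀ φ : TimeSet T → Ω → ℝ, IsAdmissible ℱ P Φ₀ φ →
      AEMeasurable (profit hT S Λ Φ₀ φ) P ∧
      ∫⁻ ω, ENNReal.ofReal (profit hT S Λ Φ₀ φ ω) ∂P < ⊤) ∧
    ∀ M N : TimeSet T → Ω → ℝ,
      IsPriceMartingale ℱ P S M → IsStochasticIntegral hT ℱ P kernel M N →
      -- optimality
      IsOptimal hT ℱ P S Λ Φ₀ (candidateRate hT S M N Λ Φ₀) ∧
      -- uniqueness, `dt ⊗ P` almost surely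
      (∀ φ : TimeSet T → Ω → ℝ, IsOptimal hT ℱ P S Λ Φ₀ φ →
        ∀ᵐ p ∂((volume : Measure (TimeSet T)).prod P),
          φ p.1 p.2 = candidateRate hT S M N Λ Φ₀ p.1 p.2) ∧
      -- the optimal value
      Integrable (profit hT S Λ Φ₀ (candidateRate hT S M N Λ Φ₀)) P ∧
      Integrable (M (time0 hT)) P ∧
      Integrable (fun p : TimeSet T × Ω =>
        (S p.1 p.2 - M (time0 hT) p.2 / T - N p.1 p.2) ^ 2)
        ((volume : Measure (TimeSet T)).prod P) ∧
      extExpectation P (profit hT S Λ Φ₀ (candidateRate hT S M N Λ Φ₀)) =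
        ((-(Φ₀ ^ 2 * Λ) / (2 * T)
          + Φ₀ * (∫ ω, (M (time0 hT) ω / T - S (time0 hT) ω) ∂P)
          + 1 / (2 * Λ) *
            ∫ ω, (∫ t, (S t ω - M (time0 hT) ω / T - N t ω) ^ 2) ∂P : ℝ) : EReal) := by
  have hSm : IsProgressive ℱ S := isProgressive_of_rightContinuous hS fun ω t _ => (hS_rcll ω t).1
  have hS2 : SqIntegrable P S := sqIntegrable_of_lintegral hT hSm hS_sq
  have hX : Integrable (fun ω => ∫ u, S u ω) P := hS2.integral.integrable one_le_two
  refine ⟨?_, fun φ hφ => ⟨(measurable_profit hT hSm hφ.progressive).aemeasurable,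
    lintegral_profit_lt_top hT hΛ hS2 hS0 hφ⟩, fun M N hM hN => ?_⟩
  · obtain ⟨M, hM⟩ := exists_isPriceMartingale hT hℱ hX
    obtain ⟨N, hN⟩ := exists_isStochasticIntegral hT hM
    exact ⟨M, N, hM, hN⟩
  have hadm := isAdmissible_candidateRate (Φ₀ := Φ₀) hΛ hS hS_rcll hS2 hM hN
  have hae := ae_candidateRate_eq (Φ₀ := Φ₀) hΛ hS hS_rcll hM hN
  have hR : SqIntegrable P (kernelRate S M Λ Φ₀) := sqIntegrable_kernelRate hT hM hSm hS2
  have hC : SqIntegrable P (candidateRate hT S M N Λ Φ₀) :=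
    MemLp.ae_eq (hae.mono fun p hp => hp.symm) hR
  have hK := (sqIntegrable_kernelProcess hT hM hS2 hS).1
  have hD : SqIntegrable P fun t ω => kernelProcess M t ω - S t ω := hK.sub hS2
  set V₀ := -(Φ₀ ^ 2 * Λ) / (2 * T) +
    (Φ₀ / T * (∫ ω, (∫ t, S t ω) ∂P) - ∫ ω, Φ₀ * S (time0 hT) ω ∂P) +
    1 / (2 * Λ) * pairing P (fun t ω => kernelProcess M t ω - S t ω)
      (fun t ω => kernelProcess M t ω - S t ω) with hV₀
  have hval : ∀ φ : TimeSet T → Ω → ℝ, IsAdmissible ℱ P Φ₀ φ → SqIntegrable P φ →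
      extExpectation P (profit hT S Λ Φ₀ φ) =
        ((V₀ - Λ / 2 * pairing P (fun t ω => φ t ω - kernelRate S M Λ Φ₀ t ω)
          (fun t ω => φ t ω - kernelRate S M Λ Φ₀ t ω) : ℝ) : EReal) := by
    intro φ hφ hφ2
    rw [extExpectation_of_integrable (hS2.integrable_profit hT hS0 hφ2).1,
      integral_profit_eq hT hΛ hM hSm hS2 hS0 hφ.progressive hφ2 hφ.liquidates]
  have hcand : extExpectation P (profit hT S Λ Φ₀ (candidateRate hT S M N Λ Φ₀)) =
      ((V₀ : ℝ) : EReal) := by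
    rw [hval _ hadm hC]
    have : pairing P (fun t ω => candidateRate hT S M N Λ Φ₀ t ω - kernelRate S M Λ Φ₀ t ω)
        (fun t ω => candidateRate hT S M N Λ Φ₀ t ω - kernelRate S M Λ Φ₀ t ω) = 0 :=
      integral_eq_zero_of_ae (hae.mono fun p hp => by simp [hp])
    rw [this, mul_zero, sub_zero]
  have hM0 : Integrable (M (time0 hT)) P := (hM.memLp hS2 _).integrable one_le_two
  have hDN : ∀ᵐ p : TimeSet T × Ω ∂((volume : Measure (TimeSet T)).prod P),
      (kernelProcess M p.1 p.2 - S p.1 p.2) ^ 2 =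
        (S p.1 p.2 - M (time0 hT) p.2 / T - N p.1 p.2) ^ 2 := by
    have hlt : ∀ᵐ p : TimeSet T × Ω ∂((volume : Measure (TimeSet T)).prod P), (p.1 : ℝ) < T :=
      Measure.quasiMeasurePreserving_fst.ae ae_lt_timeSet
    filter_upwards [hae, hlt] with p hp hpT
    rw [candidateRate_of_lt hpT, kernelRate] at hp
    have : kernelProcess M p.1 p.2 = M (time0 hT) p.2 / T + N p.1 p.2 := by
      field_simp at hp ⊢
      linarith
    rw [this]
    ring
  have hDint : Integrable (fun p : TimeSet T × Ω =>
      (S p.1 p.2 - M (time0 hT) p.2 / T - N p.1 p.2) ^ 2)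
      ((volume : Measure (TimeSet T)).prod P) := hD.integrable_sq.congr hDN
  refine ⟨⟨hadm, fun ψ hψ => ?_⟩, fun φ hφ => ?_, (hS2.integrable_profit hT hS0 hC).1, hM0, hDint, ?_⟩
  · rcases hψ.sqIntegrable_or_eq_bot hT hΛ hSm hS2 hS0 with h | h
    · rw [hcand, hval ψ hψ h, EReal.coe_le_coe_iff]
      have := pairing_self_nonneg (P := P) (f := fun t ω => ψ t ω - kernelRate S M Λ Φ₀ t ω)
      have : 0 ≤ Λ / 2 * pairing P (fun t ω => ψ t ω - kernelRate S M Λ Φ₀ t ω)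
          (fun t ω => ψ t ω - kernelRate S M Λ Φ₀ t ω) := by positivity
      linarith
    · rw [h]
      exact bot_le
  · have hle := hφ.2 _ hadm
    rw [hcand] at hle
    rcases hφ.1.sqIntegrable_or_eq_bot hT hΛ hSm hS2 hS0 with h | h
    · rw [hval φ hφ.1 h, EReal.coe_le_coe_iff] at hle
      have hE : SqIntegrable P fun t ω => φ t ω - kernelRate S M Λ Φ₀ t ω := h.sub hR
      have h0 := pairing_self_nonneg (P := P) (f := fun t ω => φ t ω - kernelRate S M Λ Φ₀ t ω)
      have h1 : pairing P (fun t ω => φ t ω - kernelRate S M Λ Φ₀ t ω)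
          (fun t ω => φ t ω - kernelRate S M Λ Φ₀ t ω) = 0 := by
        refine le_antisymm ?_ h0
        by_contra hpos
        have := mul_pos (half_pos hΛ) (not_le.1 hpos)
        linarith
      rw [pairing, integral_eq_zero_iff_of_nonneg (fun _ => mul_self_nonneg _)
        (hE.integrable_mul hE)] at h1
      filter_upwards [h1, hae] with p hp hp2
      rw [hp2]
      exact sub_eq_zero.1 (mul_self_eq_zero.1 hp)
    · rw [h] at hle
      exact absurd hle (not_le.2 (EReal.bot_lt_coe _))
  · rw [hcand, hV₀]
    congr 2
    · congr 1
      have hEM : ∫ ω, M (time0 hT) ω ∂P = ∫ ω, (∫ t, S t ω) ∂P := by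
        rw [integral_congr_ae (hM.eq_condExp (time0 hT)), integral_condExp (ℱ.le _)]
      -- If `Φ₀ = 0` then `S₀` may fail to be integrable, but both terms vanish; otherwise `S₀` is
      -- integrable and the integral can be split.
      rcases eq_or_ne Φ₀ 0 with h0 | h0
      · simp [h0]
      · have hS0' : Integrable (S (time0 hT)) P := by
          refine (hS0.const_mul Φ₀⁻¹).congr (Eventually.of_forall fun ω => ?_)
          exact inv_mul_cancel_left₀ h0 _
        rw [integral_sub (hM0.div_const T) hS0', integral_div, hEM, integral_const_mul]
        ring
    · congr 1
      simp only [pairing, ← sq]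
      rw [integral_congr_ae hDN]
      exact integral_prod_symm _ hDint
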